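/- All graphs are finite, undirected, simple. A connected graph $\Gamma$ of diameter $D$ is distance-regular with intersection numbers $b_i,c_i$ if for all vertices $x,y$ at distance $i$ exactly $b_i$ (resp. $c_i$) neighbours of $y$ are at distance $i+1$ (resp. $i-1$) from $x$; put $k=b_0$ and $a_i=k-b_i-c_i$. It has classical parameters $(D,b,\alpha,\beta)$, with $b,\alpha,\beta$ real, if $b_i=([D]-[i])(\beta-\alpha[i])$ for $0\le i\le D-1$ and $c_i=[i](1+\alpha[i-1])$ for $1\le i\le D$, where $[j]=1+b+\dots+b^{j-1}$. A Delsarte clique is a clique with $1+\frac{k}{-\theta_{\min}}$ vertices, where $\theta_{\min}$ is the smallest eigenvalue of the adjacency matrix of $\Gamma$; and $\Gamma$ is geometric if there is a set $\mathcal C$ of Delsarte cliques such that each edge lies in a unique $C\in\mathcal C$. For an integer $s\ge 2$, let $\mathcal L$ be the set of maximal cliques of $\Gamma$ with at least $a_1+2-(c_2-1)(s-1)$ vertices, called lines. $\Gamma$ has the SPLS$(s)$ property if $c_2\ge 1$, $a_1\ge(2s-1)(c_2-1)$, $(V(\Gamma),\mathcal L,\in)$ is a partial linear space (two distinct vertices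 are on at most one common line) whose point graph is $\Gamma$ (two distinct vertices are adjacent if and only if they are on a common line), each vertex is on at most $s$ lines, and each vertex $x$ has at most $c_2$ neighbours on each line not containing $x$. A Delsarte vertex is a vertex such that all lines through it are Delsarte cliques. For vertices $x,y$ at distance $2$, let $[x,y]$ be the set of lines through $x$ all of whose vertices are at distance at most $2$ from $y$. **Theorem.** Let $\Gamma$ be a distance-regular graph with classical parameters $(D,b,\alpha,\beta)$ such that $b\ge 2$ and $D\ge 3$. Let $s$ be a positive integer such that $\Gamma$ has the SPLS$(s)$ property, and let $r=[D]$. Assume that 1. $\beta>(b+2)(b+1)(s-1)-(b(b+1)+r-1)\alpha$; 2. $\beta>((b+1)(b^2+b+1)-2)(s-b)-\alpha(b+1)r+\alpha(b+1)^2$; 3. $\beta>((b+1)(b^2+b+1)-2+b)(s-b)-\alpha(r-1)+b^2-b$. Then $\Gamma$ is geometric. Moreover, $|[x,y]|=b+1$ for any two vertices $x,y$ at distance $2$, and every vertex of $\Gamma$ is a Delsarte vertex. -/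

import Mathlib

namespace ClassicalDRG

/-- `IsDistanceRegular G bi ci`: the (connected) graph `G` is distance-regular with intersection
numbers `b_i = bi i` and `c_i = ci i`. For vertices `x, y` at distance `i`, exactly `b_i`
neighbours of `y` are at distance `i + 1` from `x` and exactly `c_i` are at distance `i - 1`.
(`b_D = 0` and `c_0 = 0` are forced; values at indices beyond the diameter play no role.) -/
structure IsDistanceRegular {V : Type*} (G : SimpleGraph V) (bi ci : ℕ → ℕ) : Prop where
  connected : G.Connected
  card_b : ∀ x y : V, {z : V | G.Adj y z ∧ G.dist x z = G.dist x y + 1}.ncard = bi (G.dist x y)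
  card_c : ∀ x y : V, {z : V | G.Adj y z ∧ G.dist x z + 1 = G.dist x y}.ncard = ci (G.dist x y)

/-- The intersection number `a_i = k - b_i - c_i`, where `k = b_0` is the valency. -/
def interA (bi ci : ℕ → ℕ) (i : ℕ) : ℤ := (bi 0 : ℤ) - bi i - ci i

/-- The number `[j] = 1 + b + ⋯ + b ^ (j - 1)`, that is `(b ^ j - 1) / (b - 1)` for `b ≠ 1`,
and `j` for `b = 1`. -/
def gaussNum (b : ℝ) (j : ℕ) : ℝ := ∑ i ∈ Finset.range j, b ^ i

/-- `G` is a distance-regular graph with intersection numbers `bi`, `ci` and with classical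
parameters `(D, b, α, β)`. -/
structure HasClassicalParameters {V : Type*} (G : SimpleGraph V) (bi ci : ℕ → ℕ)
    (D : ℕ) (b α β : ℝ) : Prop where
  distanceRegular : IsDistanceRegular G bi ci
  diam_eq : G.diam = D
  b_eq : ∀ i, i < D →
    (bi i : ℝ) = (gaussNum b D - gaussNum b i) * (β - α * gaussNum b i)
  c_eq : ∀ i, 1 ≤ i → i ≤ D →
    (ci i : ℝ) = gaussNum b i * (1 + α * gaussNum b (i - 1))

open Classical in
/-- `θ` is the smallest eigenvalue of the adjacency matrix of `G`. -/
def IsSmallestEigenvalue {V : Type*} [Fintype V] (G : SimpleGraph V) (θ : ℝ) : Prop :=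
  IsLeast {t : ℝ | Module.End.HasEigenvalue (Matrix.toLin' (G.adjMatrix ℝ)) t} θ

/-- A Delsarte clique of a graph `G` of valency `k`: a clique with `1 + k / (-θ_min)` vertices. -/
def IsDelsarteClique {V : Type*} [Fintype V] (G : SimpleGraph V) (k : ℕ) (C : Set V) : Prop :=
  G.IsClique C ∧ ∃ θ : ℝ, IsSmallestEigenvalue G θ ∧ (C.ncard : ℝ) = 1 + (k : ℝ) / (-θ)

/-- A distance-regular graph `G` of valency `k` is geometric if there is a set `𝒞` of Delsarte
cliques such that each edge lies in a unique member of `𝒞`. -/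
def IsGeometric {V : Type*} [Fintype V] (G : SimpleGraph V) (k : ℕ) : Prop :=
  ∃ 𝒞 : Set (Set V), (∀ C ∈ 𝒞, IsDelsarteClique G k C) ∧
    ∀ x y : V, G.Adj x y → ∃! C : Set V, C ∈ 𝒞 ∧ x ∈ C ∧ y ∈ C

/-- `(V, L, ∈)` is a partial linear space: points and lines exist, and two distinct points are on
at most one common line. -/
structure IsPartialLinearSpace {V : Type*} (L : Set (Set V)) : Prop where
  nonempty_points : Nonempty V
  nonempty_lines : L.Nonempty
  unique_line : ∀ x y : V, x ≠ y → ∀ l ∈ L, ∀ m ∈ L, x ∈ l → y ∈ l → x ∈ m → y ∈ m → l = m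

/-- The point graph of `(V, L, ∈)`: distinct points are adjacent iff they are on a common line. -/
def pointGraph {V : Type*} (L : Set (Set V)) : SimpleGraph V where
  Adj x y := x ≠ y ∧ ∃ l ∈ L, x ∈ l ∧ y ∈ l
  symm := ⟨fun _ _ h => ⟨h.1.symm, h.2.elim fun l hl => ⟨l, hl.1, hl.2.2, hl.2.1⟩⟩⟩
  loopless := ⟨fun _ h => h.1 rfl⟩

/-- The maximal cliques of `G` with at least `a₁ + 2 - (c - 1) (s - 1)` vertices. -/
def lineSet {V : Type*} (G : SimpleGraph V) (bi ci : ℕ → ℕ) (c s : ℕ) : Set (Set V) :=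
  {C | Maximal G.IsClique C ∧
    interA bi ci 1 + 2 - ((c : ℤ) - 1) * ((s : ℤ) - 1) ≤ (C.ncard : ℤ)}

/-- The `SPLS(c, s)` property of a distance-regular graph `G` with intersection numbers
`bi`, `ci`. -/
structure HasSPLS {V : Type*} (G : SimpleGraph V) (bi ci : ℕ → ℕ) (c s : ℕ) : Prop where
  one_le_c : 1 ≤ c
  two_le_s : 2 ≤ s
  /-- the large maximal cliques are the lines of a partial linear space on the vertex set -/
  partialLinear : IsPartialLinearSpace (lineSet G bi ci c s)
  /-- `G` is the point graph of that space -/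
  eq_pointGraph : G = pointGraph (lineSet G bi ci c s)
  a_one_ge : (2 * (s : ℤ) - 1) * ((c : ℤ) - 1) ≤ interA bi ci 1
  lines_through_le : ∀ x : V, {l : Set V | l ∈ lineSet G bi ci c s ∧ x ∈ l}.ncard ≤ s
  /-- a point off a line is collinear with at most `c` points of the line -/
  tau_le : ∀ x : V, ∀ l ∈ lineSet G bi ci c s, x ∉ l →
    {y : V | y ∈ l ∧ (pointGraph (lineSet G bi ci c s)).Adj x y}.ncard ≤ c

/-- A vertex is a Delsarte vertex (with respect to the line set `L`) if all lines through it are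
Delsarte cliques. -/
def IsDelsarteVertex {V : Type*} [Fintype V] (G : SimpleGraph V) (k : ℕ) (L : Set (Set V))
    (x : V) : Prop :=
  ∀ l ∈ L, x ∈ l → IsDelsarteClique G k l

/-- The set `[x, y]` of the lines through `x` all of whose points are at distance at most `2`
from `y`. -/
def bracket {V : Type*} (G : SimpleGraph V) (L : Set (Set V)) (x y : V) : Set (Set V) :=
  {l | l ∈ L ∧ x ∈ l ∧ ∀ u ∈ l, G.dist y u ≤ 2}

end ClassicalDRG

set_option linter.unusedSectionVars false

namespace ClassicalDRG

open Finset

/-! ### Spectral tools for distance-regular graphs -/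

section DistanceRegular

open Classical

variable {V : Type*} {G : SimpleGraph V} {bi ci : ℕ → ℕ}

/-! The spectral input is that `-[D]` is the smallest eigenvalue: its standard sequence alternates
in sign, and an eigenfunction with that property sits at the bottom of the spectrum
(`eigenvalue_ge`). Positive semidefiniteness of the associated radial kernel then bounds cliques by
`1 + β` (`card_clique_le`). The intersection numbers force `b` to be an integer `B` and `α ≥ 0`.

Counting comes next. A point with `t` neighbours on a line not containing it sees at least `t` lines
of some bracket, and long lines leave no room for that in the ball of radius 2 once `t ≥ B + 2`.
Hence a point has at most `B + 1` neighbours on a line off it (`offLineBound`), which lengthens the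
guaranteed size of lines and gives `|[x,y]| ≤ B + 1`, so `c₂ ≤ (B + 1)²` and `α ≤ B`. A line
reaching distance 3 from a vertex has few points at distance 2 from it (`card_dist_two_le`); the
value of `b₀ - b₂` then leaves no alternative to `|[x,y]| = B + 1`.

The last step is to show that all vertices lie on equally many lines. For a line `m` and a point `u`
off `m` with a neighbour on it, exactly `B + 1` lines through `u` stay within distance 2 of `m`
(`card_closeLines`). For adjacent `x`, `u`, this makes closeness a `B`-regular bipartite relation
between the lines through `x` and those through `u`, the common line excluded, so the two numbers
agree; connectedness gives a constant `n`. Lines have more than `s` points and points are on at most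
`s` lines, so there are fewer lines than points, and some nonzero `v` sums to zero on every line. It
is an eigenvector for `-n`, whence `n ≤ [D]`. But `[D] β = k = ∑ (|l| - 1) ≤ n β` gives `n ≥ [D]`,
and equality forces every line to have `1 + β` points. -/

theorem exists_adj_dist_succ (hG : G.Connected) {x y : V} {n : ℕ} (h : G.dist x y = n + 1) :
    ∃ z, G.Adj y z ∧ G.dist x z = n := by
  obtain ⟨p, hp⟩ := hG.exists_walk_length_eq_dist y x
  cases p with
  | nil => simp at h
  | cons hadj q =>
    rename_i z
    refine ⟨z, hadj, ?_⟩
    have h1 : G.dist z x ≤ q.length := SimpleGraph.dist_le q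
    have h2 : q.length + 1 = n + 1 := by
      rw [← h, SimpleGraph.dist_comm, ← hp, SimpleGraph.Walk.length_cons]
    have h3 := hG.dist_triangle (u := x) (v := z) (w := y)
    have h4 : G.dist z y = 1 := SimpleGraph.dist_eq_one_iff_adj.mpr hadj.symm
    rw [SimpleGraph.dist_comm (u := z) (v := x)] at h1
    omega

theorem exists_dist_eq (hG : G.Connected) {i : ℕ} (hi : i ≤ G.diam) :
    ∃ x y, G.dist x y = i := by
  have := hG.nonempty
  obtain ⟨x, y, hxy⟩ := SimpleGraph.exists_dist_eq_diam (G := G)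
  obtain ⟨j, hj⟩ := Nat.exists_eq_add_of_le hi
  rw [hj] at hxy
  clear hj hi
  induction j generalizing y with
  | zero => exact ⟨x, y, hxy⟩
  | succ j ih =>
    obtain ⟨z, -, hz⟩ := exists_adj_dist_succ hG (n := i + j) hxy
    exact ih z hz

theorem exists_adj_dist_add_one (hG : G.Connected) {i : ℕ} (hi : i + 1 ≤ G.diam) :
    ∃ x y z, G.dist x y = i ∧ G.Adj y z ∧ G.dist x z = i + 1 := by
  obtain ⟨x, z, hxz⟩ := exists_dist_eq hG hi
  obtain ⟨y, hy, hxy⟩ := exists_adj_dist_succ hG hxz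
  exact ⟨x, y, z, hxy, hy.symm, hxz⟩

/-- The action on radial functions of the adjacency operator of a distance-regular graph. -/
noncomputable def radialOp (bi ci : ℕ → ℕ) (f : ℕ → ℝ) (i : ℕ) : ℝ :=
  ci i * f (i - 1) + ((bi 0 : ℝ) - bi i - ci i) * f i + bi i * f (i + 1)

variable [Fintype V]

/-- `v` is an eigenvector (or zero) of the adjacency operator for `θ`. -/
def IsEigenfunction (G : SimpleGraph V) (θ : ℝ) (v : V → ℝ) : Prop :=
  ∀ x, ∑ y ∈ G.neighborFinset x, v y = θ * v x

namespace IsDistanceRegular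

theorem card_filter_b (h : IsDistanceRegular G bi ci) (x y : V) :
    #{z ∈ G.neighborFinset y | G.dist x z = G.dist x y + 1} = bi (G.dist x y) := by
  rw [← h.card_b x y, ← Set.ncard_coe_finset]
  congr 1
  ext z
  simp

theorem card_filter_c (h : IsDistanceRegular G bi ci) (x y : V) :
    #{z ∈ G.neighborFinset y | G.dist x z + 1 = G.dist x y} = ci (G.dist x y) := by
  rw [← h.card_c x y, ← Set.ncard_coe_finset]
  congr 1
  ext z
  simp

theorem card_neighborFinset (h : IsDistanceRegular G bi ci) (x : V) :
    #(G.neighborFinset x) = bi 0 := by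
  have := h.card_filter_b x x
  rw [SimpleGraph.dist_self] at this
  rw [← this, Finset.filter_true_of_mem]
  intro z hz
  rw [SimpleGraph.mem_neighborFinset] at hz
  simpa using SimpleGraph.dist_eq_one_iff_adj.mpr hz

theorem ci_zero (h : IsDistanceRegular G bi ci) : ci 0 = 0 := by
  obtain ⟨x⟩ := h.connected.nonempty
  have := h.card_filter_c x x
  rw [SimpleGraph.dist_self] at this
  rw [← this]
  simp

theorem dist_le_diam (h : IsDistanceRegular G bi ci) (x y : V) : G.dist x y ≤ G.diam := by
  have := h.connected.nonempty
  exact SimpleGraph.dist_le_diam (SimpleGraph.connected_iff_ediam_ne_top.mp h.connected)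

theorem bi_diam (h : IsDistanceRegular G bi ci) : bi G.diam = 0 := by
  obtain ⟨x, y, hxy⟩ := exists_dist_eq h.connected le_rfl
  rw [← hxy, ← h.card_filter_b x y, Finset.card_eq_zero, Finset.filter_eq_empty_iff]
  intro z _ hz
  have := h.dist_le_diam x z
  omega

theorem bi_pos (h : IsDistanceRegular G bi ci) {i : ℕ} (hi : i < G.diam) : 0 < bi i := by
  obtain ⟨x, y, z, hxy, hyz, hxz⟩ := exists_adj_dist_add_one h.connected hi
  rw [← hxy, ← h.card_filter_b x y, Finset.card_pos]
  exact ⟨z, by simp [hyz, hxz, hxy]⟩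

theorem ci_pos (h : IsDistanceRegular G bi ci) {i : ℕ} (h0 : 0 < i) (hi : i ≤ G.diam) :
    0 < ci i := by
  obtain ⟨j, rfl⟩ : ∃ j, i = j + 1 := ⟨i - 1, by omega⟩
  obtain ⟨x, y, z, hxy, hyz, hxz⟩ := exists_adj_dist_add_one h.connected hi
  rw [← hxz, ← h.card_filter_c x z, Finset.card_pos]
  exact ⟨y, by simp [hyz.symm, hxz, hxy]⟩

/-- The distance to `x` changes by at most one along an edge, so the adjacency operator preserves
radial functions and acts on them tridiagonally. -/
theorem sum_neighborFinset_dist (h : IsDistanceRegular G bi ci) (f : ℕ → ℝ) (x y : V) :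
    ∑ z ∈ G.neighborFinset y, f (G.dist x z) = radialOp bi ci f (G.dist x y) := by
  set d := G.dist x y with hd
  have key : ∀ z ∈ G.neighborFinset y, f (G.dist x z) =
      (if G.dist x z + 1 = d then (f (d - 1) - f d) else 0)
        + (if G.dist x z = d + 1 then (f (d + 1) - f d) else 0) + f d := by
    intro z hz
    rw [SimpleGraph.mem_neighborFinset] at hz
    have h1 : G.dist y z = 1 := SimpleGraph.dist_eq_one_iff_adj.mpr hz
    have h2 : G.dist z y = 1 := SimpleGraph.dist_eq_one_iff_adj.mpr hz.symm
    have h3 := h.connected.dist_triangle (u := x) (v := y) (w := z)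
    have h4 := h.connected.dist_triangle (u := x) (v := z) (w := y)
    have h5 : G.dist x z + 1 = d ∨ G.dist x z = d ∨ G.dist x z = d + 1 := by omega
    rcases h5 with h5 | h5 | h5
    · have h6 : G.dist x z = d - 1 := by omega
      rw [if_pos h5, if_neg (by omega), h6]; ring
    · rw [if_neg (by omega), if_neg (by omega), h5]; ring
    · rw [if_neg (by omega), if_pos h5, h5]; ring
  rw [Finset.sum_congr rfl key, Finset.sum_add_distrib, Finset.sum_add_distrib,
    ← Finset.sum_filter, ← Finset.sum_filter, Finset.sum_const, Finset.sum_const,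
    Finset.sum_const, h.card_filter_c, h.card_filter_b, h.card_neighborFinset]
  simp only [nsmul_eq_mul, radialOp, ← hd]
  ring

theorem sum_radialOp (h : IsDistanceRegular G bi ci) {θ : ℝ} {v : V → ℝ}
    (hv : IsEigenfunction G θ v) (f : ℕ → ℝ) (x : V) :
    ∑ y, radialOp bi ci f (G.dist x y) * v y = θ * ∑ y, f (G.dist x y) * v y := by
  calc ∑ y, radialOp bi ci f (G.dist x y) * v y
      = ∑ y, ∑ z, if G.Adj y z then f (G.dist x z) * v y else 0 := by
        refine Finset.sum_congr rfl fun y _ => ?_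
        rw [← h.sum_neighborFinset_dist, Finset.sum_mul, ← Finset.sum_filter]
        refine Finset.sum_congr ?_ fun _ _ => rfl
        ext z; simp
    _ = ∑ z, ∑ y, if G.Adj y z then f (G.dist x z) * v y else 0 := Finset.sum_comm
    _ = ∑ z, f (G.dist x z) * (θ * v z) := by
        refine Finset.sum_congr rfl fun z _ => ?_
        rw [← hv z, Finset.mul_sum, ← Finset.sum_filter]
        refine Finset.sum_congr ?_ fun _ _ => rfl
        ext y; simp [SimpleGraph.adj_comm]
    _ = θ * ∑ y, f (G.dist x y) * v y := by
        rw [Finset.mul_sum]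
        exact Finset.sum_congr rfl fun _ _ => by ring

theorem sum_eq_sum_spheres (h : IsDistanceRegular G bi ci) (v : V → ℝ) (f : ℕ → ℝ) (x : V) :
    ∑ y, f (G.dist x y) * v y =
      ∑ i ∈ range (G.diam + 1), f i * ∑ y with G.dist x y = i, v y := by
  rw [← Finset.sum_fiberwise_of_maps_to (s := univ) (t := range (G.diam + 1))
    (g := fun y => G.dist x y)]
  · refine Finset.sum_congr rfl fun i _ => ?_
    rw [Finset.mul_sum]
    refine Finset.sum_congr rfl fun y hy => ?_
    rw [(Finset.mem_filter.mp hy).2]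
  · intro y _
    have := h.dist_le_diam x y
    simp only [Finset.mem_range]; omega

/-- Each distance-`i` matrix is a polynomial in the adjacency matrix, hence acts as a scalar on an
eigenspace. The three-term recurrence needs two consecutive spheres, so the induction carries both.
-/
theorem exists_sphere_sum (h : IsDistanceRegular G bi ci) (θ : ℝ) (i : ℕ) :
    ∃ t : ℝ, ∀ v : V → ℝ, IsEigenfunction G θ v → ∀ x,
      ∑ y with G.dist x y = i, v y = t * v x := by
  suffices H : ∀ i, (∃ t : ℝ, ∀ v : V → ℝ, IsEigenfunction G θ v → ∀ x,
      ∑ y with G.dist x y = i, v y = t * v x) ∧ (∃ t : ℝ, ∀ v : V → ℝ, IsEigenfunction G θ v →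
      ∀ x, ∑ y with G.dist x y = i + 1, v y = t * v x) from (H i).1
  intro i
  induction i with
  | zero =>
    constructor
    · refine ⟨1, fun v _ x => ?_⟩
      have : (univ.filter fun y => G.dist x y = 0) = {x} := by
        ext y; simp [h.connected.dist_eq_zero_iff, eq_comm]
      rw [this]; simp
    · refine ⟨θ, fun v hv x => ?_⟩
      rw [← hv x]
      refine Finset.sum_congr ?_ fun _ _ => rfl
      ext y; simp [SimpleGraph.dist_eq_one_iff_adj]
  | succ i ih =>
    refine ⟨ih.2, ?_⟩
    obtain ⟨⟨t0, h0⟩, ⟨t1, h1⟩⟩ := ih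
    rcases Nat.lt_or_ge G.diam (i + 2) with hd | hd
    · refine ⟨0, fun v _ x => ?_⟩
      rw [zero_mul, Finset.filter_eq_empty_iff.mpr, Finset.sum_empty]
      intro y _ hy
      have := h.dist_le_diam x y
      omega
    · have hc : (ci (i + 2) : ℝ) ≠ 0 := by
        have := h.ci_pos (i := i + 2) (by omega) hd
        positivity
      refine ⟨(θ * t1 - ((bi 0 : ℝ) - bi (i + 1) - ci (i + 1)) * t1 - bi i * t0) / ci (i + 2),
        fun v hv x => ?_⟩
      -- The adjacency operator applied to the indicator of the sphere of radius `i + 1` involves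
      -- only the radii `i`, `i + 1`, `i + 2`; since `c_{i+2} ≠ 0` the last sum can be solved for.
      have key := h.sum_radialOp hv (fun j => if j = i + 1 then 1 else 0) x
      have e1 : ∀ y, radialOp bi ci (fun j => if j = i + 1 then 1 else 0) (G.dist x y) * v y =
          ci (i + 2) * (if G.dist x y = i + 2 then v y else 0) +
          ((bi 0 : ℝ) - bi (i + 1) - ci (i + 1)) * (if G.dist x y = i + 1 then v y else 0) +
          bi i * (if G.dist x y = i then v y else 0) := by
        intro y
        generalize G.dist x y = d
        simp only [radialOp]
        by_cases a : d = i + 2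
        · subst a; simp
        by_cases a' : d = i + 1
        · subst a'; simp
        by_cases a'' : d = i
        · subst a''; simp
        have h5 : ¬ d - 1 = i + 1 := by omega
        simp [a, a', a'', h5]
      rw [Finset.sum_congr rfl fun y _ => e1 y, Finset.sum_add_distrib, Finset.sum_add_distrib,
        ← Finset.mul_sum, ← Finset.mul_sum, ← Finset.mul_sum, ← Finset.sum_filter,
        ← Finset.sum_filter, ← Finset.sum_filter, h0 v hv, h1 v hv] at key
      simp only [ite_mul, one_mul, zero_mul] at key
      rw [← Finset.sum_filter, h1 v hv] at key
      rw [div_mul_eq_mul_div, eq_div_iff hc]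
      linear_combination key

/-- The radial kernel of a radial eigenfunction `u` with `u 0 = 1` is positive semidefinite. -/
theorem radial_kernel_nonneg (h : IsDistanceRegular G bi ci) {θ : ℝ} {u : ℕ → ℝ} (h0 : u 0 = 1)
    (hu : ∀ i ≤ G.diam, radialOp bi ci u i = θ * u i) (w : V → ℝ) :
    0 ≤ ∑ x, ∑ y, w x * u (G.dist x y) * w y := by
  have col : ∀ x, IsEigenfunction G θ fun y => u (G.dist x y) := by
    intro x y
    rw [h.sum_neighborFinset_dist, hu _ (h.dist_le_diam x y)]
  choose t ht using fun i => h.exists_sphere_sum θ i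
  set c := ∑ i ∈ range (G.diam + 1), u i * t i with hc
  -- The kernel `M` maps into the `θ`-eigenspace and acts there as the scalar `c`, so `c ⟨Mw, w⟩ =
  -- ‖Mw‖²`. Positivity of `c` is read off a column of `M`.
  have hM : ∀ v, IsEigenfunction G θ v → ∀ x, ∑ y, u (G.dist x y) * v y = c * v x := by
    intro v hv x
    rw [h.sum_eq_sum_spheres, hc, Finset.sum_mul]
    exact Finset.sum_congr rfl fun i _ => by rw [ht i v hv]; ring
  have hcpos : 0 < c := by
    obtain ⟨x⟩ := h.connected.nonempty
    have h1 := hM _ (col x) x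
    simp only [SimpleGraph.dist_self, h0, mul_one] at h1
    rw [← h1]
    refine Finset.sum_pos' (fun y _ => mul_self_nonneg _) ⟨x, mem_univ _, ?_⟩
    simp [h0]
  set v : V → ℝ := fun y => ∑ x, w x * u (G.dist x y) with hv
  have hve : IsEigenfunction G θ v := by
    intro y
    simp only [hv]
    rw [Finset.sum_comm, Finset.mul_sum]
    refine Finset.sum_congr rfl fun x _ => ?_
    rw [← Finset.mul_sum, col x y]; ring
  have e : ∑ x, ∑ y, w x * u (G.dist x y) * w y = ∑ y, v y * w y := by
    rw [Finset.sum_comm]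
    exact Finset.sum_congr rfl fun y _ => by rw [← Finset.sum_mul]
  rw [e]
  have e2 : c * ∑ y, v y * w y = ∑ x, v x * v x := by
    calc c * ∑ y, v y * w y = ∑ y, (∑ x, u (G.dist y x) * v x) * w y := by
          rw [Finset.mul_sum]
          exact Finset.sum_congr rfl fun y _ => by rw [hM v hve]; ring
      _ = ∑ x, ∑ y, u (G.dist y x) * v x * w y := by
          rw [Finset.sum_comm]
          exact Finset.sum_congr rfl fun y _ => by rw [Finset.sum_mul]
      _ = ∑ x, v x * v x := by
          refine Finset.sum_congr rfl fun x _ => ?_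
          rw [show v x * v x = v x * ∑ y, w y * u (G.dist y x) from rfl, Finset.mul_sum]
          exact Finset.sum_congr rfl fun y _ => by ring
  have : 0 ≤ c * ∑ y, v y * w y := by
    rw [e2]; exact Finset.sum_nonneg fun x _ => mul_self_nonneg _
  exact nonneg_of_mul_nonneg_right this hcpos

/-- Delsarte's bound: evaluate the positive semidefinite kernel at the indicator of the clique,
where all distances are 0 or 1. -/
theorem clique_bound (h : IsDistanceRegular G bi ci) {θ : ℝ} {u : ℕ → ℝ} (h0 : u 0 = 1)
    (hu : ∀ i ≤ G.diam, radialOp bi ci u i = θ * u i) {C : Finset V}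
    (hC : ∀ x ∈ C, ∀ y ∈ C, x ≠ y → G.Adj x y) (hne : C.Nonempty) :
    0 ≤ 1 + ((#C : ℝ) - 1) * u 1 := by
  have key := h.radial_kernel_nonneg h0 hu (fun x => if x ∈ C then 1 else 0)
  have e : ∑ x, ∑ y, (if x ∈ C then (1 : ℝ) else 0) * u (G.dist x y) * (if y ∈ C then 1 else 0)
      = #C * (1 + ((#C : ℝ) - 1) * u 1) := by
    have : ∀ x, ∑ y, (if x ∈ C then (1 : ℝ) else 0) * u (G.dist x y) * (if y ∈ C then 1 else 0)
        = if x ∈ C then (1 + ((#C : ℝ) - 1) * u 1) else 0 := by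
      intro x
      by_cases hx : x ∈ C
      · simp only [hx, if_true, one_mul, mul_ite, mul_one, mul_zero]
        rw [← Finset.sum_filter, Finset.filter_mem_eq_inter, Finset.univ_inter,
          ← Finset.add_sum_erase _ _ hx, SimpleGraph.dist_self, h0]
        rw [Finset.sum_congr rfl (g := fun _ => u 1), Finset.sum_const, Finset.card_erase_of_mem hx,
          nsmul_eq_mul, Nat.cast_sub (Finset.card_pos.mpr hne)]
        · simp
        · intro y hy
          rw [SimpleGraph.dist_eq_one_iff_adj.mpr
            (hC x hx y (Finset.mem_of_mem_erase hy) (Finset.ne_of_mem_erase hy).symm)]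
      · simp [hx]
    rw [Finset.sum_congr rfl fun x _ => this x, ← Finset.sum_filter, Finset.filter_mem_eq_inter,
      Finset.univ_inter, Finset.sum_const, nsmul_eq_mul]
  rw [e] at key
  have : (0 : ℝ) < #C := by exact_mod_cast Finset.card_pos.mpr hne
  exact nonneg_of_mul_nonneg_right key this

/-- A positive solution of the recurrence for `-θ` with signs alternating bounds the spectrum. -/
theorem eigenvalue_ge (h : IsDistanceRegular G bi ci) {r θ : ℝ} {U : ℕ → ℝ}
    (hpos : ∀ i ≤ G.diam, 0 < U i)
    (hU : ∀ i ≤ G.diam, ci i * U (i - 1) + bi i * U (i + 1) = ((bi 0 : ℝ) - bi i - ci i + r) * U i)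
    {v : V → ℝ} (hv : IsEigenfunction G θ v) {x : V} (hx : v x ≠ 0) : -r ≤ θ := by
  set σ : ℕ → ℝ := fun i => ∑ y with G.dist x y = i, v y with hσ
  -- Giving `U i` the sign of the `i`-th sphere sum turns the pairing with `v` into the positive
  -- number `∑ U i * |σ i|`. Mismatched signs in the off-diagonal terms cost at most what the
  -- recurrence for `U` allows, namely a factor `-r`.
  set f : ℕ → ℝ := fun i => U i * SignType.sign (σ i) with hf
  have hσ0 : σ 0 = v x := by
    have : (univ.filter fun y => G.dist x y = 0) = {x} := by
      ext y; simp [h.connected.dist_eq_zero_iff, eq_comm]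
    simp only [hσ, this, Finset.sum_singleton]
  have key := h.sum_radialOp hv f x
  rw [h.sum_eq_sum_spheres v (radialOp bi ci f), h.sum_eq_sum_spheres v f] at key
  have hsgn : ∀ i, f i * σ i = U i * |σ i| := by
    intro i
    simp only [hf]
    rw [mul_assoc, sign_mul_self]
  have hS : 0 < ∑ i ∈ range (G.diam + 1), U i * |σ i| := by
    refine Finset.sum_pos' (fun i hi => mul_nonneg (hpos i ?_).le (abs_nonneg _)) ⟨0, by simp, ?_⟩
    · simp only [Finset.mem_range] at hi; omega
    · rw [hσ0]; exact mul_pos (hpos 0 (Nat.zero_le _)) (abs_pos.mpr hx)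
  have hUn : ∀ i ≤ G.diam, 0 ≤ (ci i : ℝ) * U (i - 1) := fun i hi =>
    mul_nonneg (Nat.cast_nonneg _) (hpos _ (by omega)).le
  -- Nothing is known about `U` beyond the diameter, but there its coefficient `b_D` vanishes.
  have hUn' : ∀ i ≤ G.diam, 0 ≤ (bi i : ℝ) * U (i + 1) := by
    intro i hi
    rcases hi.lt_or_eq with hi | rfl
    · exact mul_nonneg (Nat.cast_nonneg _) (hpos _ (by omega)).le
    · simp [h.bi_diam]
  have hsle : ∀ j : ℕ, ∀ a : ℝ, -|a| ≤ (SignType.sign (σ j) : ℝ) * a := by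
    intro j a
    rcases lt_trichotomy (σ j) 0 with hj | hj | hj
    · rw [sign_neg hj]; simpa using neg_abs_le (-a)
    · rw [hj]; simp
    · rw [sign_pos hj]; simpa using neg_abs_le a
  have hterm : ∀ i ∈ range (G.diam + 1), -r * (U i * |σ i|) ≤ radialOp bi ci f i * σ i := by
    intro i hi
    have hi : i ≤ G.diam := by simp only [Finset.mem_range] at hi; omega
    have h1 := mul_le_mul_of_nonneg_left (hsle (i - 1) (σ i)) (hUn i hi)
    have h2 := mul_le_mul_of_nonneg_left (hsle (i + 1) (σ i)) (hUn' i hi)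
    have h3 := hsgn i
    have h4 := congrArg (· * |σ i|) (hU i hi)
    simp only [add_mul] at h4
    simp only [radialOp]
    have h5 : f (i - 1) = U (i - 1) * SignType.sign (σ (i - 1)) := rfl
    have h6 : f (i + 1) = U (i + 1) * SignType.sign (σ (i + 1)) := rfl
    rw [h5, h6]
    nlinarith [h1, h2, h3, h4]
  have hle := Finset.sum_le_sum hterm
  rw [key, ← Finset.mul_sum, Finset.sum_congr rfl fun i _ => hsgn i] at hle
  exact le_of_mul_le_mul_right hle hS

end IsDistanceRegular

end DistanceRegular

/-! ### Classical parameters: integrality of `b`, smallest eigenvalue, clique bound -/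

section Parameters

theorem gaussNum_zero (b : ℝ) : gaussNum b 0 = 0 := by simp [gaussNum]

theorem gaussNum_one (b : ℝ) : gaussNum b 1 = 1 := by simp [gaussNum]

theorem gaussNum_two (b : ℝ) : gaussNum b 2 = 1 + b := by simp [gaussNum, sum_range_succ]

theorem gaussNum_three (b : ℝ) : gaussNum b 3 = 1 + b + b ^ 2 := by
  simp [gaussNum, sum_range_succ]

theorem gaussNum_lt {b : ℝ} (hb : 0 < b) {i j : ℕ} (h : i < j) : gaussNum b i < gaussNum b j := by
  refine Finset.sum_lt_sum_of_subset (i := i) (Finset.range_subset_range.mpr h.le) ?_ ?_ ?_ ?_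
  · simpa using h
  · simp
  · positivity
  · intro k _ _; positivity

theorem gaussNum_nonneg {b : ℝ} (hb : 0 ≤ b) (i : ℕ) : 0 ≤ gaussNum b i :=
  Finset.sum_nonneg fun k _ => pow_nonneg hb k

theorem le_gaussNum {b : ℝ} (hb : 0 ≤ b) {D : ℕ} (hD : 3 ≤ D) : 1 + b + b ^ 2 ≤ gaussNum b D := by
  rw [← gaussNum_three]
  exact Finset.sum_le_sum_of_subset_of_nonneg (Finset.range_subset_range.mpr hD)
    fun k _ _ => pow_nonneg hb k

/-- A real number that is a root of an integral monic quadratic and of a nonzero integral linear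
polynomial is an integer. -/
theorem exists_int_eq {x : ℝ} {P Q m n : ℤ} (h2 : x ^ 2 = P * x + Q) (h1 : m * x + n = 0)
    (hm : m ≠ 0) : ∃ y : ℤ, x = y := by
  have hm' : (m : ℝ) ≠ 0 := by exact_mod_cast hm
  have hx : x = algebraMap ℚ ℝ (-n / m) := by
    simp only [eq_ratCast, Rat.cast_div, Rat.cast_neg, Rat.cast_intCast]
    field_simp
    linarith
  have hint : IsIntegral ℤ x := by
    refine ⟨Polynomial.X ^ 2 - (Polynomial.C P * Polynomial.X + Polynomial.C Q), ?_, ?_⟩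
    · apply Polynomial.monic_X_pow_sub
      exact (Polynomial.degree_linear_le).trans_lt (by norm_num)
    · rw [← Polynomial.aeval_def]
      simp [h2]
  rw [hx, isIntegral_algebraMap_iff (algebraMap ℚ ℝ).injective] at hint
  obtain ⟨y, hy⟩ := IsIntegrallyClosed.isIntegral_iff.mp hint
  refine ⟨y, ?_⟩
  rw [hx, ← hy]
  simp

variable {V : Type*} {G : SimpleGraph V} {bi ci : ℕ → ℕ} {D : ℕ} {b α β : ℝ}

namespace HasClassicalParameters

theorem c_one (h : HasClassicalParameters G bi ci D b α β) (hD : 3 ≤ D) : ci 1 = 1 := by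
  have := h.c_eq 1 le_rfl (by omega)
  simp only [gaussNum_one, gaussNum_zero, Nat.sub_self] at this
  exact_mod_cast this.trans (by ring : 1 * (1 + α * 0) = 1)

theorem c_two (h : HasClassicalParameters G bi ci D b α β) (hD : 3 ≤ D) :
    (ci 2 : ℝ) = (1 + b) * (1 + α) := by
  have := h.c_eq 2 (by omega) (by omega)
  simpa [gaussNum_two, gaussNum_one] using this

theorem c_three (h : HasClassicalParameters G bi ci D b α β) (hD : 3 ≤ D) :
    (ci 3 : ℝ) = (1 + b + b ^ 2) * (ci 2 - b) := by
  have := h.c_eq 3 (by omega) hD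
  rw [c_two h hD, this, gaussNum_three, show 3 - 1 = 2 from rfl, gaussNum_two]
  ring

theorem b_zero (h : HasClassicalParameters G bi ci D b α β) (hD : 3 ≤ D) :
    (bi 0 : ℝ) = gaussNum b D * β := by
  have := h.b_eq 0 (by omega)
  rw [this, gaussNum_zero]; ring

theorem b_one (h : HasClassicalParameters G bi ci D b α β) (hD : 3 ≤ D) :
    (bi 1 : ℝ) = (gaussNum b D - 1) * (β - α) := by
  have := h.b_eq 1 (by omega)
  rw [this, gaussNum_one]; ring

theorem b_two (h : HasClassicalParameters G bi ci D b α β) (hD : 3 ≤ D) :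
    (bi 2 : ℝ) = (gaussNum b D - 1 - b) * (β - α * (1 + b)) := by
  have := h.b_eq 2 (by omega)
  rw [this, gaussNum_two]; ring

variable [Fintype V]

/-- Eliminating `α` and `β` from `c₂`, `b₀`, `b₁`, `b₂` gives a monic integral quadratic for `b`,
and `c₃` gives an integral cubic. Reducing the cubic modulo the quadratic leaves a linear relation,
which makes `b` rational and hence an integer unless the relation is trivial. -/
theorem exists_nat_eq (h : HasClassicalParameters G bi ci D b α β) (hD : 3 ≤ D) (hb : 2 ≤ b)
    (hc : 1 ≤ ci 2) (ha : 3 * ((ci 2 : ℤ) - 1) ≤ interA bi ci 1) : ∃ B : ℕ, b = B := by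
  suffices H : ∃ y : ℤ, b = y by
    obtain ⟨y, rfl⟩ := H
    have : 2 ≤ y := by exact_mod_cast hb
    exact ⟨y.toNat, by rw [← Int.cast_natCast, Int.toNat_of_nonneg (by omega)]⟩
  have h3 := h.c_three hD
  have h2 : b ^ 2 = ((((ci 2 : ℤ) - 1 - ((bi 0 : ℤ) - bi 1) : ℤ)) : ℝ) * b +
      (((bi 1 : ℤ) - bi 2 : ℤ) : ℝ) := by
    push_cast
    rw [h.c_two hD, h.b_zero hD, h.b_one hD, h.b_two hD]
    ring
  have hpos := h.distanceRegular.ci_pos (i := 3) (by norm_num) (by rw [h.diam_eq]; exact hD)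
  simp only [interA, h.c_one hD] at ha
  push_cast at ha
  have h2' := h2
  generalize hP : ((ci 2 : ℤ) - 1 - ((bi 0 : ℤ) - bi 1)) = P at h2 h2'
  generalize hg : ((bi 1 : ℤ) - bi 2) = g at h2 h2'
  generalize he : ((bi 0 : ℤ) - bi 1) = e at hP ha
  have h1 : ((g - ci 2 + 1 - e * P : ℤ) : ℝ) * b + ((ci 3 - ci 2 - e * g : ℤ) : ℝ) = 0 := by
    have hP' : (P : ℝ) = ci 2 - 1 - e := by rw [← hP]; push_cast; ring
    push_cast
    rw [h3]
    rw [hP'] at h2 ⊢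
    linear_combination (e - b) * h2
  -- If the linear relation degenerates, then with `k = c₂ - 1` and `e = b₀ - b₁` it reads `c₃ = k +
  -- 1 + e k - e² (e - k)`. The bound on `a₁` gives `e ≥ 3k + 1`, which makes this nonpositive.
  by_cases hm : g - ci 2 + 1 - e * P = 0
  · exfalso
    have hn : (ci 3 - ci 2 - e * g : ℤ) = 0 := by
      rw [hm, Int.cast_zero, zero_mul, zero_add] at h1
      exact_mod_cast h1
    have h0 : (1 : ℤ) ≤ ci 3 := by exact_mod_cast hpos
    have hc' : (1 : ℤ) ≤ ci 2 := by exact_mod_cast hc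
    obtain ⟨k, hk⟩ : ∃ k : ℤ, (ci 2 : ℤ) = k + 1 := ⟨ci 2 - 1, by ring⟩
    rw [hk] at hP ha hn hm hc'
    have hgv : g = k + e * P := by linarith
    have hPv : P = k - e := by linarith
    subst hPv
    subst hgv
    have hke : 3 * k + 1 ≤ e := by linarith
    have hk0 : 0 ≤ k := by linarith
    have e1 : (ci 3 : ℤ) = k + 1 + e * k - e * e * (e - k) := by linear_combination hn
    have e2 : e * e * (2 * k + 1) ≤ e * e * (e - k) :=
      mul_le_mul_of_nonneg_left (by linarith) (mul_self_nonneg e)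
    have e3 : e * 1 ≤ e * e := mul_le_mul_of_nonneg_left (by linarith) (by linarith)
    have e4 : e * (2 * k + 1) ≤ e * e * (2 * k + 1) :=
      mul_le_mul_of_nonneg_right (by linarith) (by linarith)
    have e5 : 1 * (k + 1) ≤ e * (k + 1) := mul_le_mul_of_nonneg_right (by linarith) (by linarith)
    linarith [mul_nonneg hk0 (by linarith : (0 : ℤ) ≤ e)]
  · exact exists_int_eq h2' h1 hm

/-- Positivity of `c₃ = (1 + b + b²)(c₂ - b)`. For integral `b` it improves to `c₂ ≥ b + 1`, which
is `α ≥ 0`. -/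
theorem lt_c_two (h : HasClassicalParameters G bi ci D b α β) (hD : 3 ≤ D) (hb : 2 ≤ b) :
    b < ci 2 := by
  have hpos := h.distanceRegular.ci_pos (i := 3) (by norm_num) (by rw [h.diam_eq]; exact hD)
  have h3 := h.c_three hD
  have : (0 : ℝ) < ci 3 := by exact_mod_cast hpos
  rw [h3] at this
  have := pos_of_mul_pos_right this (by positivity)
  linarith

theorem alpha_nonneg {B : ℕ} (h : HasClassicalParameters G bi ci D B α β) (hD : 3 ≤ D)
    (hb : 2 ≤ B) : 0 ≤ α := by
  have h1 : (B : ℝ) < ci 2 := h.lt_c_two hD (by exact_mod_cast hb)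
  have h2 : B + 1 ≤ ci 2 := by exact_mod_cast h1
  have h3 : (B : ℝ) + 1 ≤ ci 2 := by exact_mod_cast h2
  rw [h.c_two hD] at h3
  have : (0 : ℝ) < 1 + B := by positivity
  nlinarith

theorem beta_sub_pos (h : HasClassicalParameters G bi ci D b α β) (hb : 0 < b) {j : ℕ}
    (hj : j < D) : 0 < β - α * gaussNum b j := by
  have h1 := h.b_eq j hj
  have h2 : (0 : ℝ) < bi j := by
    exact_mod_cast h.distanceRegular.bi_pos (by rw [h.diam_eq]; exact hj)
  rw [h1] at h2
  exact pos_of_mul_pos_right h2 (sub_nonneg.mpr (gaussNum_lt hb hj).le)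

theorem beta_pos (h : HasClassicalParameters G bi ci D b α β) (hD : 3 ≤ D) (hb : 0 < b) :
    0 < β := by
  simpa [gaussNum_zero] using h.beta_sub_pos hb (j := 0) (by omega)

end HasClassicalParameters

/-- Absolute values of the standard sequence for the eigenvalue `-[D]`. -/
noncomputable def absStandardSeq (b α β : ℝ) (i : ℕ) : ℝ :=
  ∏ j ∈ range i, (1 + α * gaussNum b j) / (β - α * gaussNum b j)

namespace HasClassicalParameters

variable [Fintype V]

theorem absStandardSeq_pos (h : HasClassicalParameters G bi ci D b α β) (hb : 0 < b) (hα : 0 ≤ α)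
    {i : ℕ} (hi : i ≤ D) : 0 < absStandardSeq b α β i := by
  refine Finset.prod_pos fun j hj => div_pos ?_ (h.beta_sub_pos hb ?_)
  · have := mul_nonneg hα (gaussNum_nonneg hb.le j)
    linarith
  · simp only [Finset.mem_range] at hj; omega

theorem absStandardSeq_recurrence (h : HasClassicalParameters G bi ci D b α β) (hD : 3 ≤ D)
    (hb : 0 < b) {i : ℕ} (hi : i ≤ D) :
    ci i * absStandardSeq b α β (i - 1) + bi i * absStandardSeq b α β (i + 1) =
      ((bi 0 : ℝ) - bi i - ci i + gaussNum b D) * absStandardSeq b α β i := by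
  have hstep : ∀ j < D, absStandardSeq b α β (j + 1) * (β - α * gaussNum b j) =
      absStandardSeq b α β j * (1 + α * gaussNum b j) := by
    intro j hj
    have := h.beta_sub_pos hb hj
    rw [absStandardSeq, absStandardSeq, Finset.prod_range_succ, mul_assoc,
      div_mul_cancel₀ _ this.ne']
  -- The formula for `b_i` is assumed only for `i < D`; at `i = D` both sides are zero. This also
  -- cancels the uncontrolled term of index `D + 1` below.
  have hb1 : (bi i : ℝ) = (gaussNum b D - gaussNum b i) * (β - α * gaussNum b i) := by
    rcases hi.lt_or_eq with hi | rfl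
    · exact h.b_eq i hi
    · have := h.distanceRegular.bi_diam
      rw [h.diam_eq] at this
      simp [this]
  have hb2 : bi i * absStandardSeq b α β (i + 1) =
      (gaussNum b D - gaussNum b i) * (1 + α * gaussNum b i) * absStandardSeq b α β i := by
    rcases hi.lt_or_eq with hi | rfl
    · rw [hb1]
      linear_combination (gaussNum b D - gaussNum b i) * hstep i hi
    · rw [hb1]; ring
  rw [hb2, hb1, h.b_zero hD]
  cases i with
  | zero =>
    rw [h.distanceRegular.ci_zero, gaussNum_zero]
    simp
  | succ j =>
    rw [h.c_eq (j + 1) (by omega) hi, Nat.add_sub_cancel]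
    linear_combination (-gaussNum b (j + 1)) * hstep j (by omega)

theorem eigenvalue_ge (h : HasClassicalParameters G bi ci D b α β) (hD : 3 ≤ D) (hb : 0 < b)
    (hα : 0 ≤ α) {θ : ℝ} {v : V → ℝ} (hv : IsEigenfunction G θ v) {x : V} (hx : v x ≠ 0) :
    -gaussNum b D ≤ θ :=
  h.distanceRegular.eigenvalue_ge (U := absStandardSeq b α β)
    (fun i hi => h.absStandardSeq_pos hb hα (by rwa [h.diam_eq] at hi))
    (fun i hi => h.absStandardSeq_recurrence hD hb (by rwa [h.diam_eq] at hi)) hv hx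

theorem radialOp_standardSeq (h : HasClassicalParameters G bi ci D b α β) (hD : 3 ≤ D)
    (hb : 0 < b) {i : ℕ} (hi : i ≤ D) :
    radialOp bi ci (fun i => (-1) ^ i * absStandardSeq b α β i) i =
      -gaussNum b D * ((-1) ^ i * absStandardSeq b α β i) := by
  have key := h.absStandardSeq_recurrence hD hb hi
  simp only [radialOp]
  cases i with
  | zero =>
    simp only [h.distanceRegular.ci_zero, Nat.cast_zero, zero_mul, zero_add, pow_zero, pow_one,
      one_mul] at key ⊢
    linear_combination -key
  | succ j =>
    simp only [Nat.add_sub_cancel] at key ⊢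
    linear_combination (-1) ^ j * key

theorem card_clique_le (h : HasClassicalParameters G bi ci D b α β) (hD : 3 ≤ D) (hb : 0 < b)
    {C : Finset V} (hC : ∀ x ∈ C, ∀ y ∈ C, x ≠ y → G.Adj x y) : (#C : ℝ) - 1 ≤ β := by
  have hβ := h.beta_pos hD hb
  rcases C.eq_empty_or_nonempty with rfl | hne
  · simp; linarith
  have := h.distanceRegular.clique_bound (u := fun i => (-1) ^ i * absStandardSeq b α β i)
    (θ := -gaussNum b D) (by simp [absStandardSeq])
    (fun i hi => h.radialOp_standardSeq hD hb (by rwa [h.diam_eq] at hi)) hC hne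
  simp only [absStandardSeq, pow_one, Finset.prod_range_one, gaussNum_zero, mul_zero, add_zero,
    sub_zero] at this
  have e : 1 + ((#C : ℝ) - 1) * (-1 * (1 / β)) = (β - (#C - 1)) / β := by field_simp; ring
  rw [e] at this
  have := nonneg_of_mul_nonneg_left (b := β⁻¹) (by rwa [← div_eq_mul_inv]) (inv_pos.mpr hβ)
  linarith

open Classical in
theorem isSmallestEigenvalue (h : HasClassicalParameters G bi ci D b α β) (hD : 3 ≤ D) (hb : 0 < b)
    (hα : 0 ≤ α) : IsSmallestEigenvalue G (-gaussNum b D) := by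
  have happ : ∀ v : V → ℝ, ∀ x, Matrix.toLin' (G.adjMatrix ℝ) v x =
      ∑ y ∈ G.neighborFinset x, v y := fun v x => by
    rw [Matrix.toLin'_apply, SimpleGraph.adjMatrix_mulVec_apply]
  constructor
  · obtain ⟨x⟩ := h.distanceRegular.connected.nonempty
    refine Module.End.hasEigenvalue_of_hasEigenvector
      (x := fun y => (-1) ^ G.dist x y * absStandardSeq b α β (G.dist x y)) ⟨?_, ?_⟩
    · rw [Module.End.mem_eigenspace_iff]
      ext y
      rw [happ, h.distanceRegular.sum_neighborFinset_dist
        (fun i => (-1) ^ i * absStandardSeq b α β i), h.radialOp_standardSeq hD hb]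
      · simp
      · rw [← h.diam_eq]; exact h.distanceRegular.dist_le_diam x y
    · intro h0
      have := congrFun h0 x
      simp [absStandardSeq] at this
  · rintro θ hθ
    obtain ⟨v, hv, hv0⟩ := hθ.exists_hasEigenvector
    obtain ⟨x, hx⟩ := Function.ne_iff.mp hv0
    refine h.eigenvalue_ge hD hb hα (v := v) (fun y => ?_) hx
    rw [Module.End.mem_eigenspace_iff] at hv
    rw [← happ, hv]
    rfl

end HasClassicalParameters

end Parameters

/-! ### Partial linear spaces of maximal cliques and basic line counts -/

section LineSystem

open Classical

variable {V : Type*} [Fintype V]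

/-- `L` is a partial linear space with point graph `G` whose lines are maximal cliques of `G`. -/
structure IsLineSystem (G : SimpleGraph V) (L : Finset (Finset V)) : Prop where
  clique : ∀ l ∈ L, ∀ x ∈ l, ∀ y ∈ l, x ≠ y → G.Adj x y
  maximal : ∀ l ∈ L, ∀ x, x ∉ l → ∃ y ∈ l, ¬ G.Adj x y
  eq_of_mem : ∀ l ∈ L, ∀ m ∈ L, ∀ x y, x ≠ y → x ∈ l → y ∈ l → x ∈ m → y ∈ m → l = m
  exists_line : ∀ x y, G.Adj x y → ∃ l ∈ L, x ∈ l ∧ y ∈ l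

/-- The lines through `x`. -/
noncomputable def linesThrough (L : Finset (Finset V)) (x : V) : Finset (Finset V) :=
  {l ∈ L | x ∈ l}

/-- The lines through `x` all of whose points are at distance at most `2` from `y`. -/
noncomputable def bracketFinset (G : SimpleGraph V) (L : Finset (Finset V)) (x y : V) :
    Finset (Finset V) :=
  {l ∈ linesThrough L x | ∀ u ∈ l, G.dist y u ≤ 2}

/-- A point off a line has at most `t` neighbours on it. -/
def OffLineBound (G : SimpleGraph V) (L : Finset (Finset V)) (t : ℕ) : Prop :=
  ∀ x, ∀ l ∈ L, x ∉ l → #{y ∈ l | G.Adj x y} ≤ t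

theorem mem_linesThrough {L : Finset (Finset V)} {x : V} {l : Finset V} :
    l ∈ linesThrough L x ↔ l ∈ L ∧ x ∈ l := by simp [linesThrough]

theorem mem_bracketFinset {G : SimpleGraph V} {L : Finset (Finset V)} {x y : V} {l : Finset V} :
    l ∈ bracketFinset G L x y ↔ (l ∈ L ∧ x ∈ l) ∧ ∀ u ∈ l, G.dist y u ≤ 2 := by
  simp [bracketFinset, mem_linesThrough]

namespace IsLineSystem

variable {G : SimpleGraph V} {L : Finset (Finset V)}

theorem sum_neighborFinset {M : Type*} [AddCommMonoid M] (hL : IsLineSystem G L) (x : V)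
    (f : V → M) :
    ∑ z ∈ G.neighborFinset x, f z = ∑ l ∈ linesThrough L x, ∑ z ∈ l.erase x, f z := by
  rw [← Finset.sum_biUnion]
  · refine Finset.sum_congr ?_ fun _ _ => rfl
    ext z
    simp only [SimpleGraph.mem_neighborFinset, Finset.mem_biUnion, mem_linesThrough,
      Finset.mem_erase]
    constructor
    · intro hz
      obtain ⟨l, hl, hx, hzl⟩ := hL.exists_line x z hz
      exact ⟨l, ⟨hl, hx⟩, hz.ne', hzl⟩
    · rintro ⟨l, ⟨hl, hx⟩, hne, hzl⟩
      exact hL.clique l hl x hx z hzl hne.symm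
  · intro l hl m hm hlm
    rw [Finset.mem_coe, mem_linesThrough] at hl hm
    rw [Function.onFun, Finset.disjoint_left]
    intro z hz hz'
    rw [Finset.mem_erase] at hz hz'
    exact hlm (hL.eq_of_mem l hl.1 m hm.1 x z hz.1.symm hl.2 hz.2 hm.2 hz'.2)

theorem card_filter_neighborFinset (hL : IsLineSystem G L) (x : V) (p : V → Prop)
    [DecidablePred p] :
    #{z ∈ G.neighborFinset x | p z} = ∑ l ∈ linesThrough L x, #{z ∈ l | z ≠ x ∧ p z} := by
  rw [Finset.card_filter, hL.sum_neighborFinset]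
  refine Finset.sum_congr rfl fun l _ => ?_
  rw [← Finset.card_filter, ← Finset.filter_ne', Finset.filter_filter]

theorem card_filter_ne {l : Finset V} {x : V} (hx : x ∈ l) :
    (#{z ∈ l | z ≠ x} : ℝ) = #l - 1 := by
  rw [Finset.filter_ne', Finset.card_erase_of_mem hx, Nat.cast_sub (Finset.card_pos.mpr ⟨x, hx⟩)]
  simp

theorem card_neighborFinset (hL : IsLineSystem G L) (x : V) :
    (#(G.neighborFinset x) : ℝ) = ∑ l ∈ linesThrough L x, ((#l : ℝ) - 1) := by
  have := hL.card_filter_neighborFinset x fun _ => True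
  simp only [and_true, Finset.filter_true] at this
  rw [this, Nat.cast_sum]
  exact Finset.sum_congr rfl fun l hl => card_filter_ne (mem_linesThrough.mp hl).2

theorem dist_le_one (hL : IsLineSystem G L) {l : Finset V} (hl : l ∈ L) {x y : V} (hx : x ∈ l)
    (hy : y ∈ l) : G.dist x y ≤ 1 := by
  by_cases hxy : x = y
  · simp [hxy]
  · exact (SimpleGraph.dist_eq_one_iff_adj.mpr (hL.clique l hl x hx y hy hxy)).le

theorem dist_eq_two (hG : G.Connected) {x y z : V} (hxy : x ≠ y) (hn : ¬ G.Adj x y)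
    (hz : G.Adj x z) (hz' : G.Adj z y) : G.dist x y = 2 := by
  have h1 := hG.dist_triangle (u := x) (v := z) (w := y)
  have h2 := hG.one_lt_dist_of_ne_of_not_adj hxy hn
  rw [SimpleGraph.dist_eq_one_iff_adj.mpr hz, SimpleGraph.dist_eq_one_iff_adj.mpr hz'] at h1
  omega

/-- A line joining `y` to a neighbour of `x` belongs to `[y, x]`. -/
theorem mem_bracketFinset_of_adj (hL : IsLineSystem G L) (hG : G.Connected) {x y z : V}
    {m : Finset V} (hm : m ∈ L) (hy : y ∈ m) (hz : z ∈ m) (hxz : G.Adj x z) :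
    m ∈ bracketFinset G L y x := by
  refine mem_bracketFinset.mpr ⟨⟨hm, hy⟩, fun u hu => ?_⟩
  have h1 := hG.dist_triangle (u := x) (v := z) (w := u)
  have h2 := hL.dist_le_one hm hz hu
  rw [SimpleGraph.dist_eq_one_iff_adj.mpr hxz] at h1
  omega

theorem card_inter_le_one (hL : IsLineSystem G L) {l m : Finset V} (hl : l ∈ L) (hm : m ∈ L)
    (hlm : l ≠ m) : #(l ∩ m) ≤ 1 := by
  rw [Finset.card_le_one]
  intro x hx y hy
  rw [Finset.mem_inter] at hx hy
  by_contra hxy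
  exact hlm (hL.eq_of_mem l hl m hm x y hxy hx.1 hy.1 hx.2 hy.2)

theorem exists_dist_two (hL : IsLineSystem G L) (hG : G.Connected) {l : Finset V} (hl : l ∈ L)
    {y z : V} (hy : y ∉ l) (hz : z ∈ l) (hyz : G.Adj y z) : ∃ x ∈ l, G.dist y x = 2 := by
  obtain ⟨x, hx, hxy⟩ := hL.maximal l hl y hy
  have hxz : z ≠ x := fun h => hxy (h ▸ hyz)
  exact ⟨x, hx, dist_eq_two hG (fun h => hy (h ▸ hx)) hxy hyz (hL.clique l hl z hz x hx hxz)⟩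

/-- Distinct neighbours of `y` on `l` are joined to `y` by distinct lines, and each of these
contains a neighbour of `x`. -/
theorem card_adj_le_card_bracket (hL : IsLineSystem G L) (hG : G.Connected) {l : Finset V}
    (hl : l ∈ L) {x y : V} (hy : y ∉ l) (hx : x ∈ l) (hxy : G.dist y x = 2) :
    #{z ∈ l | G.Adj y z} ≤ #(bracketFinset G L y x) := by
  have hsub : {z ∈ l | G.Adj y z} ⊆ (bracketFinset G L y x).biUnion fun m => l ∩ m := by
    intro z hz
    rw [Finset.mem_filter] at hz
    obtain ⟨m, hm, hym, hzm⟩ := hL.exists_line y z hz.2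
    refine Finset.mem_biUnion.mpr ⟨m, ?_, Finset.mem_inter.mpr ⟨hz.1, hzm⟩⟩
    refine hL.mem_bracketFinset_of_adj hG hm hym hzm (hL.clique l hl x hx z hz.1 ?_)
    rintro rfl
    rw [SimpleGraph.dist_eq_one_iff_adj.mpr hz.2] at hxy
    omega
  refine (Finset.card_le_card hsub).trans ((Finset.card_biUnion_le_card_mul _ _ 1 ?_).trans
    (mul_one _).le)
  intro m hm
  refine hL.card_inter_le_one hl (mem_bracketFinset.mp hm).1.1 ?_
  rintro rfl
  exact hy (mem_bracketFinset.mp hm).1.2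

end IsLineSystem

namespace IsDistanceRegular

variable {G : SimpleGraph V} {bi ci : ℕ → ℕ}

theorem card_filter_dist (h : IsDistanceRegular G bi ci) (p : ℕ → Prop)
    [DecidablePred p] (x y : V) :
    (#{z ∈ G.neighborFinset y | p (G.dist x z)} : ℝ) =
      radialOp bi ci (fun i => if p i then 1 else 0) (G.dist x y) := by
  rw [← h.sum_neighborFinset_dist, Finset.sum_boole]

theorem card_common_adj (h : IsDistanceRegular G bi ci) {x y : V} (hxy : G.Adj x y) :
    (#{z ∈ G.neighborFinset y | G.Adj x z} : ℝ) = (bi 0 : ℝ) - bi 1 - ci 1 := by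
  have := h.card_filter_dist (fun i => i = 1) x y
  rw [SimpleGraph.dist_eq_one_iff_adj.mpr hxy] at this
  simpa [radialOp, SimpleGraph.dist_eq_one_iff_adj] using this

theorem card_common_dist_two (h : IsDistanceRegular G bi ci) {x y : V} (hxy : G.dist x y = 2) :
    #{z ∈ G.neighborFinset y | G.Adj x z} = ci 2 := by
  have := h.card_filter_dist (fun i => i = 1) x y
  rw [hxy] at this
  simpa [radialOp, SimpleGraph.dist_eq_one_iff_adj] using this

theorem card_dist_le_two (h : IsDistanceRegular G bi ci) {x y : V} (hxy : G.dist x y = 2) :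
    (#{z ∈ G.neighborFinset y | G.dist x z ≤ 2} : ℝ) = (bi 0 : ℝ) - bi 2 := by
  have := h.card_filter_dist (fun i => i ≤ 2) x y
  rw [hxy] at this
  rw [this]
  simp [radialOp]

theorem card_dist_two (h : IsDistanceRegular G bi ci) {x y : V} (hxy : G.dist x y = 3) :
    #{z ∈ G.neighborFinset y | G.dist x z = 2} = ci 3 := by
  have := h.card_filter_dist (fun i => i = 2) x y
  rw [hxy] at this
  simpa [radialOp] using this

end IsDistanceRegular

/-- A line system of a distance-regular graph with classical parameters, subject to the bounds on
`s` and `β` under which all lines are Delsarte cliques. -/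
structure IsBoundedLineSystem (G : SimpleGraph V) (bi ci : ℕ → ℕ) (D B : ℕ) (α β : ℝ) (s : ℕ)
    (L : Finset (Finset V)) : Prop where
  params : HasClassicalParameters G bi ci D B α β
  three_le : 3 ≤ D
  two_le : 2 ≤ B
  lines : IsLineSystem G L
  card_linesThrough_le : ∀ x, #(linesThrough L x) ≤ s
  offLine : OffLineBound G L (ci 2)
  one_le_s : 1 ≤ s
  a_one : (2 * (s : ℝ) - 1) * (ci 2 - 1) ≤ β + α * (gaussNum B D - 1) - 1
  bound₁ : β > ((B : ℝ) + 2) * (B + 1) * ((s : ℝ) - 1) - (B * (B + 1) + gaussNum B D - 1) * α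
  bound₂ : β > (((B : ℝ) + 1) * (B ^ 2 + B + 1) - 2) * ((s : ℝ) - B)
    - α * (B + 1) * gaussNum B D + α * (B + 1) ^ 2
  bound₃ : β > (((B : ℝ) + 1) * (B ^ 2 + B + 1) - 2 + B) * ((s : ℝ) - B)
    - α * (gaussNum B D - 1) + B ^ 2 - B

namespace IsBoundedLineSystem

variable {G : SimpleGraph V} {bi ci : ℕ → ℕ} {D B : ℕ} {α β : ℝ} {s : ℕ} {L : Finset (Finset V)}

theorem connected (H : IsBoundedLineSystem G bi ci D B α β s L) : G.Connected :=
  H.params.distanceRegular.connected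

theorem two_le' (H : IsBoundedLineSystem G bi ci D B α β s L) : (2 : ℝ) ≤ B := by
  exact_mod_cast H.two_le

theorem alpha_nonneg (H : IsBoundedLineSystem G bi ci D B α β s L) : 0 ≤ α :=
  H.params.alpha_nonneg H.three_le H.two_le

theorem beta_pos (H : IsBoundedLineSystem G bi ci D B α β s L) : 0 < β :=
  H.params.beta_pos H.three_le (by linarith [H.two_le'])

theorem le_r (H : IsBoundedLineSystem G bi ci D B α β s L) :
    1 + (B : ℝ) + (B : ℝ) ^ 2 ≤ gaussNum B D :=
  le_gaussNum (Nat.cast_nonneg _) H.three_le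

theorem card_line_le (H : IsBoundedLineSystem G bi ci D B α β s L) {l : Finset V} (hl : l ∈ L) :
    (#l : ℝ) - 1 ≤ β :=
  H.params.card_clique_le H.three_le (by linarith [H.two_le']) (H.lines.clique l hl)

theorem sum_card_line (H : IsBoundedLineSystem G bi ci D B α β s L) (x : V) :
    ∑ l ∈ linesThrough L x, ((#l : ℝ) - 1) = gaussNum B D * β := by
  rw [← H.lines.card_neighborFinset, H.params.distanceRegular.card_neighborFinset,
    H.params.b_zero H.three_le]

/-- The valency `[D] β` is shared among lines contributing at most `β` neighbours each. -/
theorem r_le_card (H : IsBoundedLineSystem G bi ci D B α β s L) (x : V) :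
    gaussNum B D ≤ #(linesThrough L x) := by
  have h1 := H.sum_card_line x
  have h2 : ∑ l ∈ linesThrough L x, ((#l : ℝ) - 1) ≤ #(linesThrough L x) * β := by
    rw [← nsmul_eq_mul]
    exact Finset.sum_le_card_nsmul _ _ _ fun l hl => H.card_line_le (mem_linesThrough.mp hl).1
  rw [h1] at h2
  exact le_of_mul_le_mul_right h2 H.beta_pos

theorem r_le_s (H : IsBoundedLineSystem G bi ci D B α β s L) : gaussNum B D ≤ s := by
  obtain ⟨x⟩ := H.connected.nonempty
  exact (H.r_le_card x).trans (by exact_mod_cast H.card_linesThrough_le x)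

theorem exists_adj_mem (H : IsBoundedLineSystem G bi ci D B α β s L) {l : Finset V} (hl : l ∈ L) :
    ∃ x ∈ l, ∃ y ∈ l, G.Adj x y := by
  obtain ⟨x₀⟩ := H.connected.nonempty
  obtain ⟨x, hx⟩ : l.Nonempty := by
    by_contra hne
    rw [Finset.not_nonempty_iff_eq_empty] at hne
    subst hne
    obtain ⟨y, hy, -⟩ := H.lines.maximal _ hl x₀ (by simp)
    simp at hy
  refine ⟨x, hx, ?_⟩
  by_contra hno
  push Not at hno
  have hpos : 0 < bi 0 := H.params.distanceRegular.bi_pos (by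
    rw [H.params.diam_eq]; exact lt_of_lt_of_le (by norm_num) H.three_le)
  rw [← H.params.distanceRegular.card_neighborFinset x, Finset.card_pos] at hpos
  obtain ⟨y, hy⟩ := hpos
  rw [SimpleGraph.mem_neighborFinset] at hy
  obtain ⟨z, hz, hyz⟩ := H.lines.maximal l hl y fun hyl => hno y hyl hy
  by_cases hzx : z = x
  · exact hyz (hzx ▸ hy.symm)
  · exact hno z hz (H.lines.clique l hl x hx z hz (Ne.symm hzx))

/-- The `a₁` common neighbours of two points of `l` lie on `l` or on one of the at most `s - 1`
other lines through `y`; each of the latter holds at most `t - 1`, since `y` itself is one of the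
`t` permitted neighbours of `x`. -/
theorem le_card_line (H : IsBoundedLineSystem G bi ci D B α β s L) {t : ℕ} (ht : 1 ≤ t)
    (hoff : OffLineBound G L t) {l : Finset V} (hl : l ∈ L) :
    β + α * (gaussNum B D - 1) - ((t : ℝ) - 1) * (s - 1) ≤ #l - 1 := by
  obtain ⟨x, hx, y, hy, hxy⟩ := H.exists_adj_mem hl
  have h1 := H.params.distanceRegular.card_common_adj hxy
  rw [H.params.b_zero H.three_le, H.params.b_one H.three_le, H.params.c_one H.three_le,
    H.lines.card_filter_neighborFinset y (G.Adj x), Nat.cast_sum,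
    ← Finset.add_sum_erase _ _ (mem_linesThrough.mpr ⟨hl, hy⟩)] at h1
  have h2 : (#{z ∈ l | z ≠ y ∧ G.Adj x z} : ℝ) ≤ #l - 2 := by
    have hsub : {z ∈ l | z ≠ y ∧ G.Adj x z} ⊆ (l.erase y).erase x := by
      intro z hz
      simp only [Finset.mem_filter] at hz
      simp [hz.1, hz.2.1, hz.2.2.ne']
    have hc := Finset.card_le_card hsub
    have hx' : x ∈ l.erase y := Finset.mem_erase.mpr ⟨hxy.ne, hx⟩
    have hc2 := Finset.card_erase_add_one hx'
    have hc3 := Finset.card_erase_add_one hy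
    have : #{z ∈ l | z ≠ y ∧ G.Adj x z} + 2 ≤ #l := by omega
    have : (#{z ∈ l | z ≠ y ∧ G.Adj x z} : ℝ) + 2 ≤ #l := by exact_mod_cast this
    linarith
  have h3 : ∑ m ∈ (linesThrough L y).erase l, (#{z ∈ m | z ≠ y ∧ G.Adj x z} : ℝ) ≤
      #((linesThrough L y).erase l) * ((t : ℝ) - 1) := by
    rw [← nsmul_eq_mul]
    refine Finset.sum_le_card_nsmul _ _ _ fun m hm => ?_
    obtain ⟨hml, hm⟩ := Finset.mem_erase.mp hm
    obtain ⟨hm, hym⟩ := mem_linesThrough.mp hm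
    have hxm : x ∉ m := fun hxm => hml (H.lines.eq_of_mem m hm l hl x y hxy.ne hxm hym hx hy)
    have hb := hoff x m hm hxm
    have hyin : y ∈ {z ∈ m | G.Adj x z} := by simp [hym, hxy]
    have heq : {z ∈ m | z ≠ y ∧ G.Adj x z} = {z ∈ m | G.Adj x z}.erase y := by
      ext z; simp only [Finset.mem_filter, Finset.mem_erase]; tauto
    have := Finset.card_erase_add_one hyin
    rw [← heq] at this
    have : #{z ∈ m | z ≠ y ∧ G.Adj x z} + 1 ≤ t := by omega
    have : (#{z ∈ m | z ≠ y ∧ G.Adj x z} : ℝ) + 1 ≤ t := by exact_mod_cast this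
    linarith
  have h4 : (#((linesThrough L y).erase l) : ℝ) ≤ s - 1 := by
    have e1 := Finset.card_erase_add_one (mem_linesThrough.mpr ⟨hl, hy⟩ : l ∈ linesThrough L y)
    have e2 := H.card_linesThrough_le y
    have : #((linesThrough L y).erase l) + 1 ≤ s := by omega
    have : (#((linesThrough L y).erase l) : ℝ) + 1 ≤ s := by exact_mod_cast this
    linarith
  have h5 : (0 : ℝ) ≤ (t : ℝ) - 1 := by
    have : (1 : ℝ) ≤ t := by exact_mod_cast ht
    linarith
  have h6 := mul_le_mul_of_nonneg_right h4 h5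
  push_cast at h1
  nlinarith [h1, h2, h3, h6]

/-- Lines of `[x,y]` meet only in `x`, and their other points are among the `b₀ - b₂` neighbours of
`x` within distance 2 of `y`. -/
theorem card_bracket_mul_le (H : IsBoundedLineSystem G bi ci D B α β s L) {x y : V}
    (hxy : G.dist x y = 2) {c : ℝ} (hc : ∀ l ∈ L, c ≤ (#l : ℝ) - 1) :
    #(bracketFinset G L x y) * c ≤
      (B + 1) * (β + α * (gaussNum B D - 1)) - α * B * (B + 1) := by
  have h1 := H.params.distanceRegular.card_dist_le_two (x := y) (y := x)
    (by rw [SimpleGraph.dist_comm, hxy])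
  rw [H.params.b_zero H.three_le, H.params.b_two H.three_le,
    H.lines.card_filter_neighborFinset x fun z => G.dist y z ≤ 2, Nat.cast_sum] at h1
  have h2 : #(bracketFinset G L x y) * c ≤
      ∑ l ∈ bracketFinset G L x y, (#{z ∈ l | z ≠ x ∧ G.dist y z ≤ 2} : ℝ) := by
    rw [← nsmul_eq_mul]
    refine Finset.card_nsmul_le_sum _ _ _ fun l hl => ?_
    obtain ⟨⟨hl, hx⟩, hd⟩ := mem_bracketFinset.mp hl
    have : {z ∈ l | z ≠ x ∧ G.dist y z ≤ 2} = {z ∈ l | z ≠ x} :=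
      Finset.filter_congr fun z hz => by simp [hd z hz]
    rw [this, IsLineSystem.card_filter_ne hx]
    exact hc l hl
  have h3 : ∑ l ∈ bracketFinset G L x y, (#{z ∈ l | z ≠ x ∧ G.dist y z ≤ 2} : ℝ) ≤
      ∑ l ∈ linesThrough L x, (#{z ∈ l | z ≠ x ∧ G.dist y z ≤ 2} : ℝ) :=
    Finset.sum_le_sum_of_subset_of_nonneg (Finset.filter_subset _ _)
      fun _ _ _ => Nat.cast_nonneg _
  linarith

end IsBoundedLineSystem

end LineSystem

/-! ### Bounds off lines and the size of brackets -/

section LineSystemBounds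

open Classical

/-- Write `t = B + 2 + k`, `X = α B (B + 1)`. Then `h1` says `(k + 1) a + X ≤ t (t - 1) S`.
Inserting `h3` yields `k < B`; inserting `h2` and `h4` then leaves `S k (B² - 2 - 2k) < 0`, which is
false for `k ≤ B - 1`. -/
theorem off_line_numeric {B t : ℕ} {a S α : ℝ} (hB : 2 ≤ B) (ht : B + 2 ≤ t) (hS : 0 ≤ S)
    (hα : 0 ≤ α)
    (h1 : t * (a - (t - 1) * S) ≤ (B + 1) * a - α * B * (B + 1))
    (h2 : ((B : ℝ) + 2) * (B + 1) * S < a + α * B * (B + 1))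
    (h3 : 2 * S * (t - 1) < a)
    (h4 : α * B * (B + 1) ≤ (t - 1) * S) : False := by
  have hB' : (2 : ℝ) ≤ B := by exact_mod_cast hB
  have hX : 0 ≤ α * B * (B + 1) := by positivity
  generalize α * B * (B + 1) = X at h1 h2 h4 hX
  obtain ⟨k, rfl⟩ : ∃ k, t = B + 2 + k := ⟨t - (B + 2), by omega⟩
  push_cast at h1 h3 h4
  have hk : (0 : ℝ) ≤ k := Nat.cast_nonneg k
  have e1 : ((k : ℝ) + 1) * (2 * S * (B + 2 + k - 1)) < (k + 1) * a :=
    mul_lt_mul_of_pos_left h3 (by positivity)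
  have e2 : (B + 1 + k) * S * (k : ℝ) < (B + 1 + k) * S * B := by nlinarith
  have hS0 : 0 < S := by
    rcases hS.lt_or_eq with h | h
    · exact h
    · rw [← h] at e2; simp at e2
  have hkB : (k : ℝ) < B := lt_of_mul_lt_mul_left e2 (by positivity)
  have hkB' : (k : ℝ) + 1 ≤ B := by
    have : k < B := by exact_mod_cast hkB
    exact_mod_cast this
  have e3 : ((k : ℝ) + 1) * ((B + 2) * (B + 1) * S - X) < (k + 1) * a :=
    mul_lt_mul_of_pos_left (by linarith) (by positivity)
  have e4 : (k : ℝ) * X ≤ k * ((B + 2 + k - 1) * S) := mul_le_mul_of_nonneg_left h4 hk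
  have e5 : 0 ≤ S * k * ((B : ℝ) ^ 2 - 2 - 2 * k) :=
    mul_nonneg (by positivity) (by nlinarith)
  nlinarith

variable {V : Type*} [Fintype V]

namespace IsBoundedLineSystem

variable {G : SimpleGraph V} {bi ci : ℕ → ℕ} {D B : ℕ} {α β : ℝ} {s : ℕ} {L : Finset (Finset V)}

theorem one_le_s_cast (H : IsBoundedLineSystem G bi ci D B α β s L) : (1 : ℝ) ≤ s := by
  exact_mod_cast H.one_le_s

/-- Descent from `c₂` to `B + 1`: while the bound `t ≥ B + 2` holds, a point attaining it has a
bracket of at least `t` lines, all long by `le_card_line`, which is numerically impossible. So `t`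
may be lowered by one. -/
theorem offLineBound (H : IsBoundedLineSystem G bi ci D B α β s L) :
    OffLineBound G L (B + 1) := by
  have hs := H.one_le_s_cast
  have hα := H.alpha_nonneg
  have hr := H.le_r
  suffices hn : ∀ n, B + 1 + n ≤ ci 2 → OffLineBound G L (B + 1 + n) →
      OffLineBound G L (B + 1) by
    rcases le_total (ci 2) (B + 1) with hc | hc
    · exact fun x l hl hx => (H.offLine x l hl hx).trans hc
    · obtain ⟨n, hcn⟩ := Nat.exists_eq_add_of_le hc
      exact hn n hcn.ge (hcn ▸ H.offLine)
  intro n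
  induction n with
  | zero => exact fun _ h => h
  | succ n ih =>
    intro hc hoff
    refine ih (by omega) fun y l hl hy => ?_
    by_contra hlt
    push Not at hlt
    obtain ⟨z, hz⟩ := Finset.card_pos.mp ((Nat.zero_le _).trans_lt hlt)
    rw [Finset.mem_filter] at hz
    obtain ⟨x, hx, hyx⟩ := H.lines.exists_dist_two H.connected hl hy hz.1 hz.2
    have hbr := H.lines.card_adj_le_card_bracket H.connected hl hy hx hyx
    obtain ⟨t, ht⟩ : ∃ t, t = B + 1 + (n + 1) := ⟨_, rfl⟩
    rw [← ht] at hc hoff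
    have htb : t ≤ #(bracketFinset G L y x) := by omega
    have htb' : (t : ℝ) ≤ #(bracketFinset G L y x) := by exact_mod_cast htb
    have hct : (t : ℝ) ≤ ci 2 := by exact_mod_cast hc
    have hline := fun l hl => H.le_card_line (by omega) hoff (l := l) hl
    have hmul := H.card_bracket_mul_le hyx hline
    have hline' := (hline l hl).trans (H.card_line_le hl)
    have ha := H.a_one
    have hb1 := H.bound₁
    have ht1 : (1 : ℝ) ≤ t := by
      have : 1 ≤ t := by omega
      exact_mod_cast this
    have hP : (2 * (s : ℝ) - 1) * (t - 1) ≤ (2 * s - 1) * (ci 2 - 1) :=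
      mul_le_mul_of_nonneg_left (by linarith) (by linarith)
    have hQ : 0 ≤ ((s : ℝ) - 1) * (t - 1) := mul_nonneg (by linarith) (by linarith)
    have hc0 : 0 ≤ β + α * (gaussNum B D - 1) - ((t : ℝ) - 1) * (s - 1) := by linarith
    have hR : α * (B * (B + 1)) ≤ α * (gaussNum B D - 1) :=
      mul_le_mul_of_nonneg_left (by linarith) hα
    exact off_line_numeric (t := t) (S := s - 1) (a := β + α * (gaussNum B D - 1)) H.two_le
      (by omega) (by linarith) hα ((mul_le_mul_of_nonneg_right htb' hc0).trans hmul)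
      (by linarith) (by linarith) (by linarith)

theorem succ_le_c_two (H : IsBoundedLineSystem G bi ci D B α β s L) : (B : ℝ) + 1 ≤ ci 2 := by
  have h1 := H.params.lt_c_two H.three_le H.two_le'
  have h2 : B + 1 ≤ ci 2 := by exact_mod_cast h1
  exact_mod_cast h2

theorem card_bracket_le (H : IsBoundedLineSystem G bi ci D B α β s L) {x y : V}
    (hxy : G.dist x y = 2) : #(bracketFinset G L x y) ≤ B + 1 := by
  by_contra hlt
  push Not at hlt
  have hn : (B : ℝ) + 2 ≤ #(bracketFinset G L x y) := by
    have : B + 2 ≤ #(bracketFinset G L x y) := by omega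
    exact_mod_cast this
  have hmul := H.card_bracket_mul_le hxy fun l hl => H.le_card_line (by omega) H.offLineBound hl
  have ha := H.a_one
  have hb1 := H.bound₁
  have hs := H.one_le_s_cast
  have hB := H.two_le'
  have hP : (2 * (s : ℝ) - 1) * B ≤ (2 * s - 1) * (ci 2 - 1) :=
    mul_le_mul_of_nonneg_left (by linarith [H.succ_le_c_two]) (by linarith)
  have hQ : 0 ≤ ((s : ℝ) - 1) * B := mul_nonneg (by linarith) (by linarith)
  push_cast at hmul
  have hc0 : 0 ≤ β + α * (gaussNum B D - 1) - ((B : ℝ) + 1 - 1) * (s - 1) := by linarith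
  have h1 := (mul_le_mul_of_nonneg_right hn hc0).trans hmul
  nlinarith

theorem c_two_le (H : IsBoundedLineSystem G bi ci D B α β s L) : ci 2 ≤ (B + 1) * (B + 1) := by
  obtain ⟨x, y, hxy⟩ := exists_dist_eq H.connected (i := 2) (by
    rw [H.params.diam_eq]; exact le_trans (by norm_num) H.three_le)
  rw [← H.params.distanceRegular.card_common_dist_two hxy]
  have hsub : {z ∈ G.neighborFinset y | G.Adj x z} ⊆
      (bracketFinset G L y x).biUnion fun m => {z ∈ m | G.Adj x z} := by
    intro z hz
    rw [Finset.mem_filter, SimpleGraph.mem_neighborFinset] at hz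
    obtain ⟨m, hm, hym, hzm⟩ := H.lines.exists_line y z hz.1
    exact Finset.mem_biUnion.mpr ⟨m, H.lines.mem_bracketFinset_of_adj H.connected hm hym hzm hz.2,
      Finset.mem_filter.mpr ⟨hzm, hz.2⟩⟩
  refine (Finset.card_le_card hsub).trans ((Finset.card_biUnion_le_card_mul _ _ (B + 1) ?_).trans
    (Nat.mul_le_mul_right _ (H.card_bracket_le (by rw [SimpleGraph.dist_comm, hxy]))))
  intro m hm
  obtain ⟨⟨hm, hy⟩, -⟩ := mem_bracketFinset.mp hm
  refine H.offLineBound x m hm fun hx => ?_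
  have := H.lines.dist_le_one hm hx hy
  omega

theorem alpha_le (H : IsBoundedLineSystem G bi ci D B α β s L) : α ≤ B := by
  have h1 : (ci 2 : ℝ) ≤ (B + 1) * (B + 1) := by exact_mod_cast H.c_two_le
  rw [H.params.c_two H.three_le] at h1
  have hB := H.two_le'
  have h2 : ((B : ℝ) + 1) * (1 + α) ≤ (B + 1) * (B + 1) := by linarith
  have := le_of_mul_le_mul_left h2 (by positivity)
  linarith

/-- The surplus `B (s - B) + B² - B` in the third hypothesis on `β` is exactly the loss `B (s - 1)`
in `le_card_line` at `t = B + 1`. -/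
theorem lt_card_line (H : IsBoundedLineSystem G bi ci D B α β s L) {l : Finset V} (hl : l ∈ L) :
    (((B : ℝ) + 1) * (B ^ 2 + B + 1) - 2) * (s - B) < #l - 1 := by
  have h1 := H.le_card_line (by omega) H.offLineBound hl
  have h2 := H.bound₃
  push_cast at h1
  linarith

/-- If a line has a point at distance `3` from `v`, few of its points are at distance `2`. -/
theorem card_dist_two_le (H : IsBoundedLineSystem G bi ci D B α β s L) {m : Finset V} (hm : m ∈ L)
    {v w₀ : V} (hw₀ : w₀ ∈ m) (hd : G.dist v w₀ = 3) :
    (#{w ∈ m | G.dist v w = 2} : ℝ) ≤ ((B : ℝ) + 1) * (B ^ 2 + B + 1) - 2 - (B + 1) := by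
  have hB := H.two_le'
  -- Count edges between the points of `m` at distance 2 from `v` and the `c₃` neighbours of `v` at
  -- distance 2 from `w₀`. Every common neighbour of `v` and such a `w` is of the latter kind, and
  -- none of them lies on `m`.
  have hcount : #{w ∈ m | G.dist v w = 2} * ci 2 ≤
      #{z ∈ G.neighborFinset v | G.dist w₀ z = 2} * (B + 1) := by
    refine Finset.card_mul_le_card_mul G.Adj (fun w hw => ?_) (fun z hz => ?_)
    · rw [Finset.mem_filter] at hw
      rw [← H.params.distanceRegular.card_common_dist_two (x := w) (y := v)
        (by rw [SimpleGraph.dist_comm, hw.2])]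
      refine Finset.card_le_card fun z hz => ?_
      rw [Finset.mem_filter, SimpleGraph.mem_neighborFinset] at hz
      rw [Finset.mem_bipartiteAbove, Finset.mem_filter, SimpleGraph.mem_neighborFinset]
      refine ⟨⟨hz.1, ?_⟩, hz.2⟩
      have e1 := H.connected.dist_triangle (u := w₀) (v := w) (w := z)
      have e2 := H.lines.dist_le_one hm hw₀ hw.1
      have e3 := H.connected.dist_triangle (u := v) (v := z) (w := w₀)
      rw [SimpleGraph.dist_eq_one_iff_adj.mpr hz.2] at e1
      rw [SimpleGraph.dist_eq_one_iff_adj.mpr hz.1, SimpleGraph.dist_comm (u := z)] at e3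
      omega
    · rw [Finset.mem_filter] at hz
      have hzm : z ∉ m := fun hzm => by
        have := H.lines.dist_le_one hm hw₀ hzm
        omega
      refine (Finset.card_le_card fun w hw => ?_).trans (H.offLineBound z m hm hzm)
      rw [Finset.mem_bipartiteBelow, Finset.mem_filter] at hw
      exact Finset.mem_filter.mpr ⟨hw.1.1, hw.2.symm⟩
  rw [H.params.distanceRegular.card_dist_two (by rw [SimpleGraph.dist_comm, hd])] at hcount
  have hcount' : (#{w ∈ m | G.dist v w = 2} : ℝ) * ci 2 ≤ ci 3 * (B + 1) := by
    exact_mod_cast hcount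
  rw [H.params.c_three H.three_le] at hcount'
  have hc : (ci 2 : ℝ) ≤ (B + 1) * (B + 1) := by exact_mod_cast H.c_two_le
  have hc0 : (0 : ℝ) < ci 2 := by linarith [H.succ_le_c_two]
  -- As `c₃ = (B² + B + 1)(c₂ - B)`, the saving over `(B + 1)(B² + B + 1)` is `B (B + 1)(B² + B + 1)
  -- / c₂`, which exceeds `B²` because `c₂ ≤ (B + 1)²`. Integrality raises it to `B² + 1`, at least
  -- `B + 3`.
  have hlt : (#{w ∈ m | G.dist v w = 2} : ℝ) * ci 2 <
      (((B : ℝ) + 1) * (B ^ 2 + B + 1) - B ^ 2) * ci 2 := by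
    have : (B : ℝ) ^ 2 * ci 2 ≤ B ^ 2 * ((B + 1) * (B + 1)) :=
      mul_le_mul_of_nonneg_left hc (by positivity)
    nlinarith
  have hlt' := lt_of_mul_lt_mul_right hlt hc0.le
  have hnat : #{w ∈ m | G.dist v w = 2} + B ^ 2 + 1 ≤ (B + 1) * (B ^ 2 + B + 1) := by
    have : (#{w ∈ m | G.dist v w = 2} : ℝ) + B ^ 2 < (B + 1) * (B ^ 2 + B + 1) := by linarith
    have : #{w ∈ m | G.dist v w = 2} + B ^ 2 < (B + 1) * (B ^ 2 + B + 1) := by exact_mod_cast this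
    omega
  have hreal : (#{w ∈ m | G.dist v w = 2} : ℝ) + B ^ 2 + 1 ≤ (B + 1) * (B ^ 2 + B + 1) := by
    exact_mod_cast hnat
  nlinarith

theorem le_beta (H : IsBoundedLineSystem G bi ci D B α β s L) :
    ((B : ℝ) + 1) * (B ^ 2 + B + 1) - 2 ≤ β := by
  have hB := H.two_le'
  have h1 := H.bound₁
  have h2 := H.r_le_s
  have h3 := H.le_r
  have h4 : (B * (B + 1) + gaussNum B D - 1) * α ≤ (B * (B + 1) + gaussNum B D - 1) * (B : ℝ) :=
    mul_le_mul_of_nonneg_left H.alpha_le (by nlinarith)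
  have h5 : ((B : ℝ) + 2) * (B + 1) * (gaussNum B D - 1) ≤ (B + 2) * (B + 1) * (s - 1) :=
    mul_le_mul_of_nonneg_left (by linarith) (by positivity)
  have h6 : ((B : ℝ) ^ 2 + 2 * B + 2) * (B ^ 2 + B) ≤
      (B ^ 2 + 2 * B + 2) * (gaussNum B D - 1) :=
    mul_le_mul_of_nonneg_left (by linarith) (by positivity)
  have h7 : (0 : ℝ) ≤ B ^ 3 * B := by positivity
  nlinarith [sq_nonneg (B : ℝ), mul_nonneg (by linarith : (0 : ℝ) ≤ B) (sq_nonneg (B : ℝ))]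

/-- With only `j ≤ B` lines in the bracket, the `b₀ - b₂` neighbours of `x` within distance 2 of `y`
number at most `j β + (s - j) K`, where `K = (B + 1)(B² + B + 1) - 2`. Since `K ≤ β` the worst case
is `j = B`, and that contradicts the second hypothesis on `β`. -/
theorem card_bracket (H : IsBoundedLineSystem G bi ci D B α β s L) {x y : V}
    (hxy : G.dist x y = 2) : #(bracketFinset G L x y) = B + 1 := by
  refine (H.card_bracket_le hxy).antisymm ?_
  by_contra hlt
  push Not at hlt
  have hj : (#(bracketFinset G L x y) : ℝ) ≤ B := by
    have : #(bracketFinset G L x y) ≤ B := by omega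
    exact_mod_cast this
  have hyx : G.dist y x = 2 := by rw [SimpleGraph.dist_comm, hxy]
  have h1 := H.params.distanceRegular.card_dist_le_two hyx
  have hsub : bracketFinset G L x y ⊆ linesThrough L x := Finset.filter_subset _ _
  rw [H.params.b_zero H.three_le, H.params.b_two H.three_le,
    H.lines.card_filter_neighborFinset x fun z => G.dist y z ≤ 2, Nat.cast_sum,
    ← Finset.sum_sdiff hsub] at h1
  have h2 : ∑ l ∈ bracketFinset G L x y, (#{z ∈ l | z ≠ x ∧ G.dist y z ≤ 2} : ℝ) ≤
      #(bracketFinset G L x y) * β := by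
    rw [← nsmul_eq_mul]
    refine Finset.sum_le_card_nsmul _ _ _ fun l hl => ?_
    obtain ⟨⟨hl, hx⟩, -⟩ := mem_bracketFinset.mp hl
    refine le_trans ?_ (H.card_line_le hl)
    rw [← IsLineSystem.card_filter_ne hx]
    exact_mod_cast Finset.card_le_card fun z hz => by
      rw [Finset.mem_filter] at hz ⊢
      exact ⟨hz.1, hz.2.1⟩
  have h3 : ∑ l ∈ linesThrough L x \ bracketFinset G L x y,
      (#{z ∈ l | z ≠ x ∧ G.dist y z ≤ 2} : ℝ) ≤
      #(linesThrough L x \ bracketFinset G L x y) * (((B : ℝ) + 1) * (B ^ 2 + B + 1) - 2) := by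
    rw [← nsmul_eq_mul]
    refine Finset.sum_le_card_nsmul _ _ _ fun l hl => ?_
    obtain ⟨hlx, hlb⟩ := Finset.mem_sdiff.mp hl
    obtain ⟨hl, hx⟩ := mem_linesThrough.mp hlx
    rw [mem_bracketFinset] at hlb
    push Not at hlb
    obtain ⟨w₀, hw₀, hd⟩ := hlb ⟨hl, hx⟩
    have e1 := H.connected.dist_triangle (u := y) (v := x) (w := w₀)
    have e2 := H.lines.dist_le_one hl hx hw₀
    have hB := H.two_le'
    -- Points of this line are at distance 2 or 3 from `y`, as `w₀` is at distance 3.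
    refine le_trans ?_ ((H.card_dist_two_le hl hw₀ (v := y) (by omega)).trans (by linarith))
    exact_mod_cast Finset.card_le_card fun z hz => by
      rw [Finset.mem_filter] at hz ⊢
      have e3 := H.connected.dist_triangle (u := y) (v := z) (w := w₀)
      have e4 := H.lines.dist_le_one hl hz.1 hw₀
      exact ⟨hz.1, by omega⟩
  have h4 : (#(linesThrough L x \ bracketFinset G L x y) : ℝ) ≤
      s - #(bracketFinset G L x y) := by
    have e1 := Finset.card_sdiff_add_card_eq_card hsub
    have e2 := H.card_linesThrough_le x
    have : #(linesThrough L x \ bracketFinset G L x y) + #(bracketFinset G L x y) ≤ s := by omega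
    have : (#(linesThrough L x \ bracketFinset G L x y) : ℝ) + #(bracketFinset G L x y) ≤ s := by
      exact_mod_cast this
    linarith
  have hK : (0 : ℝ) ≤ ((B : ℝ) + 1) * (B ^ 2 + B + 1) - 2 := by
    have := H.two_le'
    nlinarith [sq_nonneg (B : ℝ)]
  have h5 := mul_le_mul_of_nonneg_right h4 hK
  have h6 := mul_nonneg (sub_nonneg.mpr hj) (sub_nonneg.mpr H.le_beta)
  have h7 := H.bound₂
  linarith

end IsBoundedLineSystem

end LineSystemBounds

/-! ### Constant number of lines per vertex; all lines are Delsarte cliques -/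

section DelsarteLines

open Classical

variable {V : Type*} [Fintype V]

/-- The lines through `u` all of whose points are at distance at most `2` from those of `m`. -/
noncomputable def closeLines (G : SimpleGraph V) (L : Finset (Finset V)) (u : V) (m : Finset V) :
    Finset (Finset V) :=
  {n ∈ linesThrough L u | ∀ v ∈ n, ∀ w ∈ m, G.dist v w ≤ 2}

theorem mem_closeLines {G : SimpleGraph V} {L : Finset (Finset V)} {u : V} {m n : Finset V} :
    n ∈ closeLines G L u m ↔ (n ∈ L ∧ u ∈ n) ∧ ∀ v ∈ n, ∀ w ∈ m, G.dist v w ≤ 2 := by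
  simp [closeLines, mem_linesThrough]

namespace IsBoundedLineSystem

variable {G : SimpleGraph V} {bi ci : ℕ → ℕ} {D B : ℕ} {α β : ℝ} {s : ℕ} {L : Finset (Finset V)}

theorem card_closeLines_le (H : IsBoundedLineSystem G bi ci D B α β s L) {u x : V} {m : Finset V}
    (hm : m ∈ L) (hu : u ∉ m) (hx : x ∈ m) (hux : G.Adj u x) :
    #(closeLines G L u m) ≤ B + 1 := by
  obtain ⟨w, hw, huw⟩ := H.lines.exists_dist_two H.connected hm hu hx hux
  rw [← H.card_bracket huw]
  refine Finset.card_le_card fun n hn => ?_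
  rw [mem_closeLines] at hn
  exact mem_bracketFinset.mpr ⟨hn.1, fun v hv => by
    rw [SimpleGraph.dist_comm]; exact hn.2 v hv w hw⟩

/-- A line `n` that is not close has a point `v` at distance more than 2 from some point of `m`. If
`n ∈ [u,w]` for some `w` on `m`, that distance is 3 and every such `w` is at distance exactly 2 from
`v`. -/
theorem card_bracket_fiber_le (H : IsBoundedLineSystem G bi ci D B α β s L) {u : V}
    {m n : Finset V} (hm : m ∈ L) (hn : n ∈ linesThrough L u \ closeLines G L u m) :
    #{w ∈ m | G.dist u w = 2 ∧ n ∈ bracketFinset G L u w} ≤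
      (B + 1) * (B ^ 2 + B + 1) - (B + 3) := by
  rw [Finset.mem_sdiff, mem_linesThrough, mem_closeLines] at hn
  obtain ⟨hnu, hnc⟩ := hn
  push Not at hnc
  obtain ⟨v, hv, w₀, hw₀, hd⟩ := hnc hnu
  rcases {w ∈ m | G.dist u w = 2 ∧ n ∈ bracketFinset G L u w}.eq_empty_or_nonempty with h | h
  · simp [h]
  have hfar : ∀ w ∈ m, n ∈ bracketFinset G L u w → G.dist v w = 2 ∧ G.dist v w₀ = 3 := by
    intro w hw hwn
    have e1 := (mem_bracketFinset.mp hwn).2 v hv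
    have e2 := H.lines.dist_le_one hm hw hw₀
    have e3 := H.connected.dist_triangle (u := v) (v := w) (w := w₀)
    rw [SimpleGraph.dist_comm] at e1
    omega
  obtain ⟨w, hw⟩ := h
  rw [Finset.mem_filter] at hw
  have key := H.card_dist_two_le hm hw₀ (hfar w hw.1 hw.2.2).2
  have hle : #{w ∈ m | G.dist u w = 2 ∧ n ∈ bracketFinset G L u w} ≤ #{w ∈ m | G.dist v w = 2} :=
    Finset.card_le_card fun z hz => by
      rw [Finset.mem_filter] at hz ⊢
      exact ⟨hz.1, (hfar z hz.1 hz.2.2).1⟩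
  refine hle.trans (Nat.le_sub_of_add_le ?_)
  have : (#{w ∈ m | G.dist v w = 2} : ℝ) + (B + 3) ≤ (B + 1) * (B ^ 2 + B + 1) := by linarith
  exact_mod_cast this

theorem card_closeLines (H : IsBoundedLineSystem G bi ci D B α β s L) {u x : V} {m : Finset V}
    (hm : m ∈ L) (hu : u ∉ m) (hx : x ∈ m) (hux : G.Adj u x) :
    #(closeLines G L u m) = B + 1 := by
  refine (H.card_closeLines_le hm hu hx hux).antisymm ?_
  by_contra hlt
  push Not at hlt
  have hB := H.two_le'
  -- Pairs `(w, n)` with `n ∈ [u,w]` not close to `m`: each `w` has at least `B + 1 - j` of them,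
  -- where `j` is the number of close lines.
  have hcount : #{w ∈ m | G.dist u w = 2} * (B + 1 - #(closeLines G L u m)) ≤
      #(linesThrough L u \ closeLines G L u m) * ((B + 1) * (B ^ 2 + B + 1) - (B + 3)) := by
    refine Finset.card_mul_le_card_mul (fun w n => n ∈ bracketFinset G L u w)
      (fun w hw => ?_) (fun n hn => ?_)
    · rw [Finset.mem_filter] at hw
      rw [← H.card_bracket hw.2]
      refine (Finset.le_card_sdiff _ _).trans (Finset.card_le_card fun n hn => ?_)
      rw [Finset.mem_sdiff] at hn
      rw [Finset.mem_bipartiteAbove, Finset.mem_sdiff]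
      exact ⟨⟨mem_linesThrough.mpr (mem_bracketFinset.mp hn.1).1, hn.2⟩, hn.1⟩
    · rw [Finset.bipartiteBelow, Finset.filter_filter]
      exact H.card_bracket_fiber_le hm hn
  have hW : #m ≤ (B + 1) + #{w ∈ m | G.dist u w = 2} := by
    have hsub : m ⊆ {w ∈ m | G.Adj u w} ∪ {w ∈ m | G.dist u w = 2} := by
      intro w hw
      rw [Finset.mem_union, Finset.mem_filter, Finset.mem_filter]
      by_cases huw : G.Adj u w
      · exact Or.inl ⟨hw, huw⟩
      · refine Or.inr ⟨hw, IsLineSystem.dist_eq_two H.connected (fun h => hu (h ▸ hw)) huw hux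
          (H.lines.clique m hm x hx w hw ?_)⟩
        rintro rfl
        exact huw hux
    exact (Finset.card_le_card hsub).trans ((Finset.card_union_le _ _).trans
      (Nat.add_le_add_right (H.offLineBound u m hm hu) _))
  have hN : #(linesThrough L u \ closeLines G L u m) + #(closeLines G L u m) ≤ s := by
    have hsub : closeLines G L u m ⊆ linesThrough L u := Finset.filter_subset _ _
    rw [Finset.card_sdiff_add_card_eq_card hsub]
    exact H.card_linesThrough_le u
  have hcast : B + 3 ≤ (B + 1) * (B ^ 2 + B + 1) := by nlinarith [H.two_le]
  have hcount' : (#{w ∈ m | G.dist u w = 2} : ℝ) * (B + 1 - #(closeLines G L u m)) ≤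
      #(linesThrough L u \ closeLines G L u m) * (((B : ℝ) + 1) * (B ^ 2 + B + 1) - (B + 3)) := by
    have := (Nat.cast_le (α := ℝ)).mpr hcount
    push_cast [Nat.cast_sub hcast, Nat.cast_sub hlt.le] at this
    exact this
  have hW' : (#m : ℝ) ≤ (B + 1) + #{w ∈ m | G.dist u w = 2} := by exact_mod_cast hW
  have hN' : (#(linesThrough L u \ closeLines G L u m) : ℝ) + #(closeLines G L u m) ≤ s := by
    exact_mod_cast hN
  have hline := H.lt_card_line hm
  have hsB : (B : ℝ) + 1 ≤ s := by nlinarith [H.r_le_s, H.le_r]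
  have hk : (0 : ℝ) ≤ ((B : ℝ) + 1) * (B ^ 2 + B + 1) - (B + 3) := by
    have : ((B + 3 : ℕ) : ℝ) ≤ (((B + 1) * (B ^ 2 + B + 1) : ℕ) : ℝ) := Nat.cast_le.mpr hcast
    push_cast at this
    linarith
  have hj : (#(closeLines G L u m) : ℝ) ≤ B := by
    have : #(closeLines G L u m) ≤ B := by omega
    exact_mod_cast this
  obtain ⟨k, hkdef⟩ : ∃ k : ℝ, k = ((B : ℝ) + 1) * (B ^ 2 + B + 1) - (B + 3) := ⟨_, rfl⟩
  rw [← hkdef] at hk hcount'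
  have hline' : k * (s - B) + (B + 1) * (s - B) < #m - 1 := by
    rw [hkdef]; linarith
  have h1 : k * (s - B) < #{w ∈ m | G.dist u w = 2} := by nlinarith
  have h2 := mul_le_mul_of_nonneg_right
    (le_sub_iff_add_le.mpr hN' : _ ≤ (s : ℝ) - #(closeLines G L u m)) hk
  have h3 := mul_lt_mul_of_pos_right h1
    (by linarith : (0 : ℝ) < B + 1 - #(closeLines G L u m))
  -- The identity `(s - B)(B + 1 - j) - (s - j) = (B - j)(s - B - 1)` closes the double count.
  have h4 : 0 ≤ k * (B - #(closeLines G L u m)) * (s - B - 1) :=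
    mul_nonneg (mul_nonneg hk (by linarith)) (by linarith)
  nlinarith

/-- The line `l` meets `m` in `x` and so is itself close; `B` others remain. -/
theorem card_closeLines_erase (H : IsBoundedLineSystem G bi ci D B α β s L) {u x : V}
    {l m : Finset V} (hl : l ∈ L) (hul : u ∈ l) (hxl : x ∈ l) (hux : G.Adj u x) (hm : m ∈ L)
    (hxm : x ∈ m) (hml : m ≠ l) : #((closeLines G L u m).erase l) = B := by
  have hum : u ∉ m := fun hum => hml (H.lines.eq_of_mem m hm l hl u x hux.ne hum hxm hul hxl)
  rw [Finset.card_erase_of_mem, H.card_closeLines hm hum hxm hux, Nat.add_sub_cancel]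
  refine mem_closeLines.mpr ⟨⟨hl, hul⟩, fun v hv w hw => ?_⟩
  have e1 := H.connected.dist_triangle (u := v) (v := x) (w := w)
  have e2 := H.lines.dist_le_one hl hv hxl
  have e3 := H.lines.dist_le_one hm hxm hw
  omega

theorem card_linesThrough_eq_of_adj (H : IsBoundedLineSystem G bi ci D B α β s L) {x u : V}
    (hxu : G.Adj x u) : #(linesThrough L x) = #(linesThrough L u) := by
  obtain ⟨l, hl, hx, hu⟩ := H.lines.exists_line x u hxu
  have key : #((linesThrough L x).erase l) * B = #((linesThrough L u).erase l) * B := by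
    refine Finset.card_mul_eq_card_mul (fun m n => ∀ v ∈ n, ∀ w ∈ m, G.dist v w ≤ 2)
      (fun m hm => ?_) (fun n hn => ?_)
    · rw [Finset.mem_erase, mem_linesThrough] at hm
      rw [← H.card_closeLines_erase hl hu hx hxu.symm hm.2.1 hm.2.2 hm.1]
      congr 1
      ext n
      rw [Finset.mem_bipartiteAbove, Finset.mem_erase, Finset.mem_erase, mem_linesThrough,
        mem_closeLines]
      tauto
    · rw [Finset.mem_erase, mem_linesThrough] at hn
      rw [← H.card_closeLines_erase hl hx hu hxu hn.2.1 hn.2.2 hn.1]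
      congr 1
      ext m
      rw [Finset.mem_bipartiteBelow, Finset.mem_erase, Finset.mem_erase, mem_linesThrough,
        mem_closeLines]
      have : (∀ v ∈ n, ∀ w ∈ m, G.dist v w ≤ 2) ↔ ∀ w ∈ m, ∀ v ∈ n, G.dist w v ≤ 2 :=
        ⟨fun h w hw v hv => by rw [SimpleGraph.dist_comm]; exact h v hv w hw,
          fun h v hv w hw => by rw [SimpleGraph.dist_comm]; exact h w hw v hv⟩
      tauto
  have hB := H.two_le
  have h1 := Nat.eq_of_mul_eq_mul_right (by omega) key
  rw [← Finset.card_erase_add_one (mem_linesThrough.mpr ⟨hl, hx⟩),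
    ← Finset.card_erase_add_one (mem_linesThrough.mpr ⟨hl, hu⟩), h1]

theorem card_linesThrough_eq (H : IsBoundedLineSystem G bi ci D B α β s L) (x u : V) :
    #(linesThrough L x) = #(linesThrough L u) := by
  obtain ⟨p⟩ := H.connected.preconnected x u
  induction p with
  | nil => rfl
  | cons h _ ih => exact (H.card_linesThrough_eq_of_adj h).trans ih

theorem card_lines_lt (H : IsBoundedLineSystem G bi ci D B α β s L) : #L < Fintype.card V := by
  have hB := H.two_le'
  have hsl : ∀ l ∈ L, s + 1 ≤ #l := by
    intro l hl
    have h1 := H.lt_card_line hl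
    have h2 : (1 : ℝ) + B + B ^ 2 ≤ s := H.le_r.trans H.r_le_s
    have h3 : (2 : ℝ) ≤ ((B : ℝ) + 1) * (B ^ 2 + B + 1) - 2 := by nlinarith
    have h4 : (2 : ℝ) * (s - B) ≤ (((B : ℝ) + 1) * (B ^ 2 + B + 1) - 2) * (s - B) :=
      mul_le_mul_of_nonneg_right h3 (by nlinarith)
    have : (s : ℝ) + 1 ≤ #l := by nlinarith
    exact_mod_cast this
  have hcount : #L * (s + 1) ≤ #(univ : Finset V) * s := by
    refine Finset.card_mul_le_card_mul (fun l x => x ∈ l) (fun l hl => ?_) (fun x _ => ?_)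
    · rw [Finset.bipartiteAbove, Finset.filter_mem_eq_inter, Finset.univ_inter]
      exact hsl l hl
    · exact H.card_linesThrough_le x
  have hV : 0 < Fintype.card V := Fintype.card_pos_iff.mpr H.connected.nonempty
  rw [Finset.card_univ] at hcount
  by_contra hlt
  push Not at hlt
  nlinarith [H.one_le_s]

theorem exists_line_sums_zero (H : IsBoundedLineSystem G bi ci D B α β s L) :
    ∃ v : V → ℝ, v ≠ 0 ∧ ∀ l ∈ L, ∑ x ∈ l, v x = 0 := by
  let f : (V → ℝ) →ₗ[ℝ] (L → ℝ) := LinearMap.pi fun l => ∑ x ∈ l.1, LinearMap.proj x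
  have hf : LinearMap.ker f ≠ ⊥ := LinearMap.ker_ne_bot_of_finrank_lt (by
    simpa using H.card_lines_lt)
  obtain ⟨v, hv, hv0⟩ := (Submodule.ne_bot_iff _).mp hf
  refine ⟨v, hv0, fun l hl => ?_⟩
  have := congrFun (LinearMap.mem_ker.mp hv) ⟨l, hl⟩
  simpa [f] using this

theorem card_linesThrough (H : IsBoundedLineSystem G bi ci D B α β s L) (x : V) :
    (#(linesThrough L x) : ℝ) = gaussNum B D := by
  refine le_antisymm ?_ (H.r_le_card x)
  obtain ⟨v, hv0, hv⟩ := H.exists_line_sums_zero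
  obtain ⟨y, hy⟩ := Function.ne_iff.mp hv0
  -- On each line through `z` the values at the other points sum to `-v z`.
  have heig : IsEigenfunction G (-#(linesThrough L x)) v := by
    intro z
    rw [H.lines.sum_neighborFinset, H.card_linesThrough_eq x z, neg_mul, ← mul_neg,
      ← nsmul_eq_mul, ← Finset.sum_const]
    refine Finset.sum_congr rfl fun l hl => ?_
    obtain ⟨hl, hz⟩ := mem_linesThrough.mp hl
    have := Finset.add_sum_erase l v hz
    rw [hv l hl] at this
    linarith
  have := H.params.eigenvalue_ge H.three_le (by linarith [H.two_le']) H.alpha_nonneg heig hy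
  linarith

theorem card_line (H : IsBoundedLineSystem G bi ci D B α β s L) {l : Finset V} (hl : l ∈ L) :
    (#l : ℝ) = 1 + β := by
  obtain ⟨x, hx, -⟩ := H.exists_adj_mem hl
  have h1 := H.sum_card_line x
  rw [← H.card_linesThrough x, ← nsmul_eq_mul, ← Finset.sum_const] at h1
  have := (Finset.sum_eq_sum_iff_of_le
    fun l hl => H.card_line_le (mem_linesThrough.mp hl).1).mp h1 l (mem_linesThrough.mpr ⟨hl, hx⟩)
  linarith

theorem isDelsarteClique (H : IsBoundedLineSystem G bi ci D B α β s L) {l : Finset V}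
    (hl : l ∈ L) : IsDelsarteClique G (bi 0) (l : Set V) := by
  have hB := H.two_le'
  refine ⟨fun x hx y hy hxy => H.lines.clique l hl x hx y hy hxy, -gaussNum B D,
    H.params.isSmallestEigenvalue H.three_le (by linarith) H.alpha_nonneg, ?_⟩
  have hr : (0 : ℝ) < gaussNum B D := by nlinarith [H.le_r]
  rw [Set.ncard_coe_finset, H.card_line hl, H.params.b_zero H.three_le, neg_neg,
    mul_div_cancel_left₀ _ hr.ne']

end IsBoundedLineSystem

/-- The lines of a graph with the `SPLS` property, as finsets. -/
noncomputable def lineFinset (G : SimpleGraph V) (bi ci : ℕ → ℕ) (c s : ℕ) : Finset (Finset V) :=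
  {l | (l : Set V) ∈ lineSet G bi ci c s}

theorem mem_lineFinset {G : SimpleGraph V} {bi ci : ℕ → ℕ} {c s : ℕ} {l : Finset V} :
    l ∈ lineFinset G bi ci c s ↔ (l : Set V) ∈ lineSet G bi ci c s := by simp [lineFinset]

/-- Transfers counts of lines from sets, as in the definitions, to finsets, as in the proof. -/
theorem ncard_lineSet_filter {G : SimpleGraph V} {bi ci : ℕ → ℕ} {c s : ℕ} {p : Set V → Prop}
    {F : Finset (Finset V)}
    (hF : ∀ l : Finset V, l ∈ F ↔ (l : Set V) ∈ lineSet G bi ci c s ∧ p l) :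
    {l | l ∈ lineSet G bi ci c s ∧ p l}.ncard = #F := by
  rw [← Set.ncard_coe_finset, ← Set.ncard_image_of_injective (F : Set (Finset V))
    (Finset.coe_injective (α := V))]
  congr 1
  ext l
  simp only [Set.mem_ofPred_eq, Set.mem_image, Finset.mem_coe]
  constructor
  · intro hl
    exact ⟨l.toFinset, (hF _).mpr (by simpa using hl), by simp⟩
  · rintro ⟨l, hl, rfl⟩
    exact (hF l).mp hl

theorem isLineSystem_lineFinset {G : SimpleGraph V} {bi ci : ℕ → ℕ} {c s : ℕ}
    (h : HasSPLS G bi ci c s) : IsLineSystem G (lineFinset G bi ci c s) where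
  clique l hl x hx y hy hxy := (mem_lineFinset.mp hl).1.prop hx hy hxy
  maximal l hl x hx := by
    by_contra hcon
    push Not at hcon
    have hmax := (mem_lineFinset.mp hl).1
    have hins : G.IsClique (insert x (l : Set V)) :=
      hmax.prop.insert fun y hy _ => hcon y hy
    exact hx (hmax.le_of_ge hins (Set.subset_insert _ _) (Set.mem_insert _ _))
  eq_of_mem l hl m hm x y hxy hxl hyl hxm hym := Finset.coe_injective
    (h.partialLinear.unique_line x y hxy l (mem_lineFinset.mp hl) m (mem_lineFinset.mp hm)
      hxl hyl hxm hym)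
  exists_line x y hxy := by
    rw [h.eq_pointGraph] at hxy
    obtain ⟨-, l, hl, hx, hy⟩ := hxy
    exact ⟨l.toFinset, mem_lineFinset.mpr (by simpa using hl), by simpa using hx, by simpa using hy⟩

theorem ncard_linesThrough {G : SimpleGraph V} {bi ci : ℕ → ℕ} {c s : ℕ} (x : V) :
    {l : Set V | l ∈ lineSet G bi ci c s ∧ x ∈ l}.ncard =
      #(linesThrough (lineFinset G bi ci c s) x) :=
  ncard_lineSet_filter fun l => by rw [mem_linesThrough, mem_lineFinset, Finset.mem_coe]

theorem ncard_bracket {G : SimpleGraph V} {bi ci : ℕ → ℕ} {c s : ℕ} (x y : V) :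
    (bracket G (lineSet G bi ci c s) x y).ncard =
      #(bracketFinset G (lineFinset G bi ci c s) x y) :=
  ncard_lineSet_filter fun l => by
    rw [mem_bracketFinset, mem_lineFinset, and_assoc]; rfl

theorem offLineBound_lineFinset {G : SimpleGraph V} {bi ci : ℕ → ℕ} {c s : ℕ}
    (h : HasSPLS G bi ci c s) : OffLineBound G (lineFinset G bi ci c s) c := by
  intro x l hl hx
  have := h.tau_le x l (mem_lineFinset.mp hl) hx
  rw [← h.eq_pointGraph] at this
  rw [← Set.ncard_coe_finset]
  simpa using this

end DelsarteLines

end ClassicalDRG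

theorem theorem15 {V : Type*} [Fintype V] (G : SimpleGraph V) (bi ci : ℕ → ℕ)
    (D : ℕ) (b α β r : ℝ) (s : ℕ)
    (hG : ClassicalDRG.HasClassicalParameters G bi ci D b α β)
    (hb : 2 ≤ b) (hD : 3 ≤ D) (hs : 0 < s)
    (hSPLS : ClassicalDRG.HasSPLS G bi ci (ci 2) s)
    (hr : r = ClassicalDRG.gaussNum b D)
    (h1 : β > (b + 2) * (b + 1) * ((s : ℝ) - 1) - (b * (b + 1) + r - 1) * α)
    (h2 : β > ((b + 1) * (b ^ 2 + b + 1) - 2) * ((s : ℝ) - b) - α * (b + 1) * r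
      + α * (b + 1) ^ 2)
    (h3 : β > ((b + 1) * (b ^ 2 + b + 1) - 2 + b) * ((s : ℝ) - b) - α * (r - 1)
      + b ^ 2 - b) :
    ClassicalDRG.IsGeometric G (bi 0) ∧
    (∀ x y : V, G.dist x y = 2 →
      ((ClassicalDRG.bracket G (ClassicalDRG.lineSet G bi ci (ci 2) s) x y).ncard : ℝ) = b + 1) ∧
    (∀ x : V, ClassicalDRG.IsDelsarteVertex G (bi 0)
      (ClassicalDRG.lineSet G bi ci (ci 2) s) x) := by
  classical
  subst hr
  have hs2 : (2 : ℤ) ≤ s := by exact_mod_cast hSPLS.two_le_s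
  have hc1 : (1 : ℤ) ≤ ci 2 := by exact_mod_cast hSPLS.one_le_c
  have ha := hSPLS.a_one_ge
  -- From `s ≥ 2`, the factor `2s - 1` in the bound on `a₁` is at least 3.
  obtain ⟨B, rfl⟩ := hG.exists_nat_eq hD hb hSPLS.one_le_c (by nlinarith)
  have H : ClassicalDRG.IsBoundedLineSystem G bi ci D B α β s
      (ClassicalDRG.lineFinset G bi ci (ci 2) s) :=
    { params := hG
      three_le := hD
      two_le := by exact_mod_cast hb
      lines := ClassicalDRG.isLineSystem_lineFinset hSPLS
      card_linesThrough_le := fun x =>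
        ClassicalDRG.ncard_linesThrough (G := G) x ▸ hSPLS.lines_through_le x
      offLine := ClassicalDRG.offLineBound_lineFinset hSPLS
      one_le_s := hs
      a_one := by
        have ha' := (Int.cast_le (R := ℝ)).mpr ha
        simp only [ClassicalDRG.interA, hG.c_one hD] at ha'
        push_cast at ha'
        rw [hG.b_zero hD, hG.b_one hD] at ha'
        linarith
      bound₁ := h1
      bound₂ := h2
      bound₃ := h3 }
  have hDel : ∀ l ∈ ClassicalDRG.lineSet G bi ci (ci 2) s,
      ClassicalDRG.IsDelsarteClique G (bi 0) l := by
    intro l hl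
    have := H.isDelsarteClique (l := l.toFinset)
      (ClassicalDRG.mem_lineFinset.mpr (by simpa using hl))
    simpa using this
  refine ⟨⟨ClassicalDRG.lineSet G bi ci (ci 2) s, hDel, fun x y hxy => ?_⟩, fun x y hxy => ?_,
    fun x l hl _ => hDel l hl⟩
  · have hxy' := hxy
    rw [hSPLS.eq_pointGraph] at hxy'
    obtain ⟨-, l, hl, hx, hy⟩ := hxy'
    exact ⟨l, ⟨hl, hx, hy⟩, fun m hm =>
      hSPLS.partialLinear.unique_line x y hxy.ne m hm.1 l hl hm.2.1 hm.2.2 hx hy⟩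
  · rw [ClassicalDRG.ncard_bracket, H.card_bracket hxy]
    push_cast
    rfl
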